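/- **Setting.** Let $C=(C_{i,j})_{i,j\in I}$ ($I$ finite) be a symmetrizable generalized Cartan matrix, with $r_i\in\mathbb N^*$ such that $B_{i,j}=r_iC_{i,j}$ is symmetric, and let $(\mathfrak h,\{\alpha_i\},\{\alpha_i^\vee\})$ be a realization of $C$ over $\mathbb Q$ ($\dim_{\mathbb Q}\mathfrak h=2|I|-\operatorname{rank}C$, the $\alpha_i\in\mathfrak h^*$ and the $\alpha_i^\vee\in\mathfrak h$ linearly independent, $\alpha_j(\alpha_i^\vee)=C_{i,j}$). Let $q\in\mathbb C^*$ not be a root of unity, with a fixed logarithm defining $q^s$ for $s\in\mathbb Q$, and $q_i=q^{r_i}$. The quantum affinization $\mathcal U_q(\hat{\mathfrak g})$ is the $\mathbb C$-algebra with generators $x^\pm_{i,r}$ ($r\in\mathbb Z$), $k_h$ ($h\in\mathfrak h$), $h_{i,m}$ ($m\in\mathbb Z\setminus\{0\}$) and the following relations, where $x_i^\pm(w)=\sum_r x^\pm_{i,r}w^r$, $\delta(z)=\sum_{r\in\mathbb Z}z^r$ and $\phi_i^\pm(z)=\sum_{m\ge0}\phi^\pm_{i,\pm m}z^{\pm m}=k_{\pm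 r_i\alpha_i^\vee}\exp\bigl(\pm(q-q^{-1})\sum_{m\ge1}h_{i,\pm m}z^{\pm m}\bigr)$: $$k_hk_{h'}=k_{h+h'},\quad k_0=1,\quad k_h\phi_i^\pm(z)=\phi_i^\pm(z)k_h,\quad k_hx_j^\pm(z)=q^{\pm\alpha_j(h)}x_j^\pm(z)k_h,$$ $$\phi_i^{\epsilon}(z)x_j^\pm(w)=\frac{q^{\pm B_{i,j}}w-z}{w-q^{\pm B_{i,j}}z}\,x_j^\pm(w)\phi_i^{\epsilon}(z)\quad(\text{expanded in powers of } z/w \text{ for } \epsilon=+,\ \text{of } w/z \text{ for } \epsilon=-),$$ $$x_i^+(z)x_j^-(w)-x_j^-(w)x_i^+(z)=\frac{\delta_{i,j}}{q_i-q_i^{-1}}\Bigl(\delta\bigl(\tfrac wz\bigr)\phi_i^+(w)-\delta\bigl(\tfrac zw\bigr)\phi_i^-(z)\Bigr),$$ $$(w-q^{\pm B_{i,j}}z)x_i^\pm(z)x_j^\pm(w)=(q^{\pm B_{i,j}}w-z)x_j^\pm(w)x_i^\pm(z),$$ and, for $i\ne j$ and $s=1-C_{i,j}$, $$\sum_{\pi\in\Sigma_s}\sum_{k=0}^{s}(-1)^k\begin{bmatrix}s\\k\end{bmatrix}_{q_i}x_i^\pm(w_{\pi(1)})\cdots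 x_i^\pm(w_{\pi(k)})x_j^\pm(z)x_i^\pm(w_{\pi(k+1)})\cdots x_i^\pm(w_{\pi(s)})=0.$$ Let $\mathcal U_q(\hat{\mathfrak h})$ be the subalgebra generated by the $k_h$ and $h_{i,m}$, and $\mathcal U_q(\mathfrak h)$ the one generated by the $k_h$. Put $\mathcal A=\{f/g : f,g\in\mathbb C[u^{\pm1}],\ g(1)\neq0\}\subset\mathbb C(u)$, $\mathcal U'_q(\hat{\mathfrak g})=\mathcal U_q(\hat{\mathfrak g})\otimes\mathbb C(u)$ and $\mathcal U^u_q(\hat{\mathfrak g})=\mathcal U_q(\hat{\mathfrak g})\otimes\mathcal A\subset\mathcal U'_q(\hat{\mathfrak g})$. Weight spaces are $V_\omega=\{v : k_hv=q^{\omega(h)}v\ \forall h\in\mathfrak h\}$, $\omega\in\mathfrak h^*$. $\mathrm{Mod}(\mathcal U_q(\mathfrak h))$ consists of the $\mathcal U_q(\mathfrak h)$-modules $V=\bigoplus_\omega V_\omega$ such that every $V_\omega$ is finite dimensional, for all $\omega,i$ one has $V_{\omega\pm r\alpha_i}=0$ for $r$ large, and there are $\lambda_1,\dots,\lambda_t\in\mathfrak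 h^*$ such that every weight lies in some $\lambda_j-\sum_i\mathbb N\alpha_i$. $\mathrm{Mod}(\mathcal U_q(\hat{\mathfrak g}))$ consists of the $\mathcal U_q(\hat{\mathfrak g})$-modules whose restriction to $\mathcal U_q(\mathfrak h)$ is in $\mathrm{Mod}(\mathcal U_q(\mathfrak h))$. $\mathrm{Mod}(\mathcal U'_q(\hat{\mathfrak g}))$ consists of the $\mathcal U'_q(\hat{\mathfrak g})$-modules $V$ having a $\mathbb C$-subspace $W$ such that: (i) the multiplication map $W\otimes_{\mathbb C}\mathbb C(u)\to V$ is an isomorphism; (ii) $W$ is $\mathcal U_q(\mathfrak h)$-stable and in $\mathrm{Mod}(\mathcal U_q(\mathfrak h))$; (iii) the image of $W\otimes\mathbb C[u^{\pm1}]$ in $V$ is stable under $\mathcal U_q(\hat{\mathfrak h})$; (iv) for all $\omega\in\mathfrak h^*$, $i\in I$, $r\in\mathbb Z$ and each sign $\pm$ there are finitely many $\mathbb C$-linear maps $f^\pm_{k,k',\lambda}:W_\omega\to V$ ($k,k'\ge0$, $\lambda\in\mathbb C^*$) with $x^\pm_{i,r\pm m}w=\sum\lambda^mu^{km}m^{k'}f^\pm_{k,k',\lambda}(w)$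 for all $m\ge0$, $w\in W_\omega$; and such that (v) $V=\bigoplus V_{(\lambda,\Psi)}$, the sum being over all pairs $(\lambda,\Psi)$ with $\lambda\in\mathfrak h^*$, $\Psi=(\Psi^\pm_{i,\pm m})_{i\in I,m\ge0}$, $\Psi^\pm_{i,\pm m}\in\mathbb C[u^{\pm1}]$, $\Psi^\pm_{i,0}=q_i^{\pm\lambda(\alpha_i^\vee)}$, where $V_{(\lambda,\Psi)}=\{v\in V_\lambda : \exists p\ge 0\ \forall i\in I,\ m\ge0,\ (\phi^\pm_{i,\pm m}-\Psi^\pm_{i,\pm m})^pv=0\}$. An *$\mathcal A$-form* of $V\in\mathrm{Mod}(\mathcal U'_q(\hat{\mathfrak g}))$ is an $\mathcal A$-submodule $\tilde V\subset V$ which is stable under $\mathcal U^u_q(\hat{\mathfrak g})$, spans $V$ over $\mathbb C(u)$, and is such that $\tilde V\cap V_\lambda$ is a finitely generated $\mathcal A$-module for every $\lambda\in\mathfrak h^*$. Its *specialization* is the $\mathcal U_q(\hat{\mathfrak g})$-module $(\tilde V)_{u=1}=\tilde V/(u-1)\tilde V$. **Theorem 4.6.** Let $V\in\mathrm{Mod}(\mathcal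 U'_q(\hat{\mathfrak g}))$ and $v\in V\setminus\{0\}$. Then $\mathcal U'_q(\hat{\mathfrak g}).v$ is an object of $\mathrm{Mod}(\mathcal U'_q(\hat{\mathfrak g}))$ and $\tilde V(v)=\mathcal U^u_q(\hat{\mathfrak g}).v$ is an $\mathcal A$-form of $\mathcal U'_q(\hat{\mathfrak g}).v$. Moreover $(\tilde V(v))_{u=1}$ is an object of $\mathrm{Mod}(\mathcal U_q(\hat{\mathfrak g}))$, is nonzero, and is generated as a $\mathcal U_q(\hat{\mathfrak g})$-module by the image of $v$. -/

import Mathlib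

open scoped TensorProduct BigOperators

noncomputable section

namespace QAff

/-! ## Cartan data -/

/-- A symmetrizable generalized Cartan matrix with a chosen symmetrization, a realization of it
over `ℚ`, and a nonzero complex number `q = exp logq` which is not a root of unity.  The choice of
a logarithm of `q` fixes the rational powers `q ^ s = exp (s * logq)`. -/
structure Datum (I : Type*) [Fintype I] [DecidableEq I]
    (𝔥 : Type*) [AddCommGroup 𝔥] [Module ℚ 𝔥] where
  C : Matrix I I ℤ
  diag : ∀ i, C i i = 2
  offdiag : ∀ i j, i ≠ j → C i j ≤ 0
  zero_iff : ∀ i j, C i j = 0 ↔ C j i = 0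
  r : I → ℕ
  r_pos : ∀ i, 0 < r i
  symm : ∀ i j, (r i : ℤ) * C i j = (r j : ℤ) * C j i
  finite : Module.Finite ℚ 𝔥
  finrank_add : Module.finrank ℚ 𝔥 + (C.map (Int.cast : ℤ → ℚ)).rank = 2 * Fintype.card I
  root : I → Module.Dual ℚ 𝔥
  coroot : I → 𝔥
  root_indep : LinearIndependent ℚ root
  coroot_indep : LinearIndependent ℚ coroot
  root_coroot : ∀ i j, root j (coroot i) = (C i j : ℚ)
  logq : ℂ
  not_root_of_unity : ∀ n : ℕ, 0 < n → Complex.exp logq ^ n ≠ 1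

variable {I : Type*} [Fintype I] [DecidableEq I] {𝔥 : Type*} [AddCommGroup 𝔥] [Module ℚ 𝔥]
  (D : Datum I 𝔥)

/-- The power `q ^ s` for rational `s`. -/
def Datum.qpow (s : ℚ) : ℂ := Complex.exp ((s : ℂ) * D.logq)

/-- The symmetrized Cartan matrix `B = diag(r) C`. -/
def Datum.B (i j : I) : ℤ := (D.r i : ℤ) * D.C i j

/-- `q_i = q ^ (r_i)`. -/
def Datum.qi (i : I) : ℂ := D.qpow (D.r i)

/-- `λ ≥ μ`, that is, `λ - μ` is a sum of simple roots. -/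
def Datum.Dominates (lam mu : Module.Dual ℚ 𝔥) : Prop :=
  ∃ n : I → ℕ, lam - mu = ∑ i, n i • D.root i

/-- The quantum integer `[n]_v`. -/
def qInt (v : ℂ) (n : ℕ) : ℂ := (v ^ n - (v⁻¹) ^ n) / (v - v⁻¹)

/-- The quantum factorial `[n]_v!`. -/
def qFactorial (v : ℂ) (n : ℕ) : ℂ := ∏ k ∈ Finset.range n, qInt v (k + 1)

/-- The quantum binomial coefficient. -/
def qBinom (v : ℂ) (n k : ℕ) : ℂ := qFactorial v n / (qFactorial v k * qFactorial v (n - k))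

/-! ## The quantum affinization

Signs are elements of `ℤˣ`. -/

/-- The generators `k_h`, `x^±_{i,r}`, `h_{i,m}` (`m ≠ 0`). -/
inductive Gen (I : Type*) (𝔥 : Type*)
  | k (h : 𝔥) : Gen I 𝔥
  | x (ε : ℤˣ) (i : I) (r : ℤ) : Gen I 𝔥
  | h (i : I) (m : {m : ℤ // m ≠ 0}) : Gen I 𝔥

section phi
variable {A : Type*} [Ring A] [Algebra ℂ A]

/-- The power series `ε (q - q⁻¹) ∑_{p ≥ 1} h_{i, ε p} t ^ p`. -/
def hSeries (h : I → {m : ℤ // m ≠ 0} → A) (ε : ℤˣ) (i : I) : PowerSeries A :=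
  PowerSeries.mk fun p : ℕ =>
    if hp : p = 0 then 0
    else (((ε : ℤ) : ℂ) * (D.qpow 1 - D.qpow (-1))) •
      h i ⟨(ε : ℤ) * p, mul_ne_zero (Units.ne_zero ε) (by exact_mod_cast hp)⟩

/-- `φ^ε_{i, ε m}` for `m ≥ 0`: the coefficient of `t ^ m` in
`k_{ε r_i α_i^∨} exp (ε (q - q⁻¹) ∑_{p ≥ 1} h_{i, ε p} t ^ p)` (here `t = z ^ ε`).
As the series in the exponential has no constant term, only its powers of exponent at most `m`
contribute to the coefficient of `t ^ m`. -/
def phiNat (k : 𝔥 → A) (h : I → {m : ℤ // m ≠ 0} → A) (ε : ℤˣ) (i : I) (m : ℕ) : A :=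
  k (((ε : ℤ) * (D.r i : ℤ)) • D.coroot i) *
    ∑ n ∈ Finset.range (m + 1),
      ((n.factorial : ℂ)⁻¹) • PowerSeries.coeff m (hSeries D h ε i ^ n)

/-- `φ^ε_{i, m}` for all integers `m`; it vanishes if `m` and `ε` have opposite signs. -/
def phiInt (k : 𝔥 → A) (h : I → {m : ℤ // m ≠ 0} → A) (ε : ℤˣ) (i : I) (m : ℤ) : A :=
  if 0 ≤ (ε : ℤ) * m then phiNat D k h ε i m.natAbs else 0

end phi

/-- The rational function `(c w - z) / (w - c z)`, expanded in powers of `t = z / w`. -/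
def gPlus (c : ℂ) : PowerSeries ℂ :=
  (PowerSeries.C c - PowerSeries.X) * (1 - PowerSeries.C c * PowerSeries.X)⁻¹

/-- The rational function `(c w - z) / (w - c z)`, expanded in powers of `t = w / z`. -/
def gMinus (c : ℂ) : PowerSeries ℂ :=
  (PowerSeries.C c * PowerSeries.X - 1) * (PowerSeries.X - PowerSeries.C c)⁻¹

/-- The free algebra on the generators. -/
abbrev Free (I : Type*) (𝔥 : Type*) := FreeAlgebra ℂ (Gen I 𝔥)

def fk (h : 𝔥) : Free I 𝔥 := FreeAlgebra.ι ℂ (Gen.k h)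
def fx (ε : ℤˣ) (i : I) (r : ℤ) : Free I 𝔥 := FreeAlgebra.ι ℂ (Gen.x ε i r)
def fh (i : I) (m : {m : ℤ // m ≠ 0}) : Free I 𝔥 := FreeAlgebra.ι ℂ (Gen.h i m)
def fphi (ε : ℤˣ) (i : I) (m : ℤ) : Free I 𝔥 := phiInt D fk fh ε i m

/-- The defining relations of the quantum affinization, coefficient by coefficient in the formal
variables of the currents `x^±_i(w) = ∑_r x^±_{i,r} w ^ r`, `φ^±_i(z) = ∑_m φ^±_{i,m} z ^ m`. -/
inductive Rel : Free I 𝔥 → Free I 𝔥 → Prop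
  | k_add (h h' : 𝔥) : Rel (fk h * fk h') (fk (h + h'))
  | k_zero : Rel (fk 0) 1
  | k_phi (h : 𝔥) (ε : ℤˣ) (i : I) (m : ℤ) :
      Rel (fk h * fphi D ε i m) (fphi D ε i m * fk h)
  | k_x (h : 𝔥) (ε : ℤˣ) (j : I) (r : ℤ) :
      Rel (fk h * fx ε j r) (D.qpow (((ε : ℤ) : ℚ) * D.root j h) • (fx ε j r * fk h))
  /-- `φ⁺_i(z) x^ε_j(w) = g (z / w) x^ε_j(w) φ⁺_i(z)`, coefficient of `z ^ m w ^ r`. -/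
  | phi_plus_x (ε : ℤˣ) (i j : I) (m : ℕ) (r : ℤ) :
      Rel (fphi D 1 i m * fx ε j r)
        (∑ p ∈ Finset.range (m + 1),
          PowerSeries.coeff p (gPlus (D.qpow ((ε : ℤ) * D.B i j : ℤ))) •
            (fx ε j (r + p) * fphi D 1 i ((m : ℤ) - p)))
  /-- `φ⁻_i(z) x^ε_j(w) = g (w / z) x^ε_j(w) φ⁻_i(z)`, coefficient of `z ^ (-m) w ^ r`. -/
  | phi_minus_x (ε : ℤˣ) (i j : I) (m : ℕ) (r : ℤ) :
      Rel (fphi D (-1) i (-(m : ℤ)) * fx ε j r)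
        (∑ p ∈ Finset.range (m + 1),
          PowerSeries.coeff p (gMinus (D.qpow ((ε : ℤ) * D.B i j : ℤ))) •
            (fx ε j (r - p) * fphi D (-1) i (-((m : ℤ) - p))))
  | x_plus_x_minus (i j : I) (r s : ℤ) :
      Rel (fx 1 i r * fx (-1) j s - fx (-1) j s * fx 1 i r)
        (if i = j then
          ((D.qi i - (D.qi i)⁻¹)⁻¹) • (fphi D 1 i (r + s) - fphi D (-1) i (r + s)) else 0)
  | x_x (ε : ℤˣ) (i j : I) (r s : ℤ) :
      Rel (fx ε i (r + 1) * fx ε j s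
            - D.qpow ((ε : ℤ) * D.B i j : ℤ) • (fx ε i r * fx ε j (s + 1)))
        (D.qpow ((ε : ℤ) * D.B i j : ℤ) • (fx ε j s * fx ε i (r + 1))
            - fx ε j (s + 1) * fx ε i r)
  /-- The affine quantum Serre relations; here `s = 1 - C i j`. -/
  | serre (ε : ℤˣ) (i j : I) (hij : i ≠ j) (s : ℕ) (hs : (s : ℤ) = 1 - D.C i j)
      (r : Fin s → ℤ) (r' : ℤ) :
      Rel (∑ π : Equiv.Perm (Fin s), ∑ k ∈ Finset.range (s + 1),
            ((-1 : ℂ) ^ k * qBinom (D.qi i) s k) •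
              (((List.ofFn fun a : Fin s => (fx ε i (r (π a)) : Free I 𝔥)).take k).prod
                * fx ε j r' *
                ((List.ofFn fun a : Fin s => (fx ε i (r (π a)) : Free I 𝔥)).drop k).prod))
        0

/-- The quantum affinization `U_q(ĝ)`. -/
def Uq : Type _ := RingQuot (Rel D)

instance : Ring (Uq D) := inferInstanceAs (Ring (RingQuot (Rel D)))
instance : Algebra ℂ (Uq D) := inferInstanceAs (Algebra ℂ (RingQuot (Rel D)))

/-- The projection of the free algebra onto `U_q(ĝ)`. -/
def Uq.proj : Free I 𝔥 →ₐ[ℂ] Uq D := RingQuot.mkAlgHom ℂ (Rel D)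

def Uq.k (h : 𝔥) : Uq D := Uq.proj D (fk h)
def Uq.x (ε : ℤˣ) (i : I) (r : ℤ) : Uq D := Uq.proj D (fx ε i r)
def Uq.h (i : I) (m : {m : ℤ // m ≠ 0}) : Uq D := Uq.proj D (fh i m)
def Uq.phi (ε : ℤˣ) (i : I) (m : ℤ) : Uq D := Uq.proj D (fphi D ε i m)

/-- The subalgebra `U_q(ĥ)` generated by the `k_h` and the `h_{i,m}`. -/
def UqCartan : Subalgebra ℂ (Uq D) :=
  Algebra.adjoin ℂ (Set.range (Uq.k D) ∪ Set.range fun p : I × {m : ℤ // m ≠ 0} => Uq.h D p.1 p.2)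

/-! ## The rings `ℂ(u)`, `ℂ[u, u⁻¹]` and `𝒜`, and scalar extensions of `U_q(ĝ)` -/

/-- The field `ℂ(u)`. -/
abbrev Cu := RatFunc ℂ

/-- The ring of Laurent polynomials `ℂ[u, u⁻¹]` inside `ℂ(u)`. -/
def laurentRing : Subalgebra ℂ Cu := Algebra.adjoin ℂ {RatFunc.X, RatFunc.X⁻¹}

/-- The local ring `𝒜` of the rational functions `f / g` with `g(1) ≠ 0`.  (Since `u` is a unit at
`u = 1`, it makes no difference whether `f, g` are polynomials or Laurent polynomials.) -/
def 𝒜 : Subalgebra ℂ Cu where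
  carrier := {x | ∃ f g : Polynomial ℂ, g.eval 1 ≠ 0 ∧
    x = algebraMap (Polynomial ℂ) Cu f / algebraMap (Polynomial ℂ) Cu g}
  mul_mem' := by
    rintro _ _ ⟨f, g, hg, rfl⟩ ⟨f', g', hg', rfl⟩
    exact ⟨f * f', g * g', by simp [hg, hg'], by rw [map_mul, map_mul, div_mul_div_comm]⟩
  add_mem' := by
    rintro _ _ ⟨f, g, hg, rfl⟩ ⟨f', g', hg', rfl⟩
    have h0 : ∀ p : Polynomial ℂ, p.eval 1 ≠ 0 → algebraMap (Polynomial ℂ) Cu p ≠ 0 := by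
      intro p hp h
      have : p = 0 := (map_eq_zero_iff _ (RatFunc.algebraMap_injective ℂ)).1 h
      simp [this] at hp
    exact ⟨f * g' + g * f', g * g', by simp [hg, hg'],
      by rw [map_add, map_mul, map_mul, map_mul, div_add_div _ _ (h0 g hg) (h0 g' hg')]⟩
  algebraMap_mem' := fun c => ⟨Polynomial.C c, 1, by simp, by
    rw [map_one, div_one]; rfl⟩

/-- `u - 1` as an element of `𝒜`. -/
def uSubOne : 𝒜 :=
  ⟨RatFunc.X - 1, Polynomial.X - 1, 1, by simp, by simp⟩

/-- `U'_q(ĝ) = U_q(ĝ) ⊗ ℂ(u)`. -/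
abbrev UqCu := Cu ⊗[ℂ] Uq D

/-- The inclusion of `U_q(ĝ)` in `U'_q(ĝ)`. -/
def incl : Uq D →ₐ[ℂ] UqCu D := Algebra.TensorProduct.includeRight

/-- `U^u_q(ĝ) = U_q(ĝ) ⊗ 𝒜`, as a subalgebra of `U'_q(ĝ)`. -/
def UqA : Subalgebra ℂ (UqCu D) :=
  (Algebra.TensorProduct.map 𝒜.val (AlgHom.id ℂ (Uq D))).range

lemma incl_mem_UqA (a : Uq D) : incl D a ∈ UqA D := ⟨1 ⊗ₜ a, by simp [incl]⟩

lemma smul_mem_UqA (f : 𝒜) {a : UqCu D} (ha : a ∈ UqA D) : (f : Cu) • a ∈ UqA D := by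
  have hf : algebraMap Cu (UqCu D) (f : Cu) ∈ UqA D :=
    ⟨f ⊗ₜ 1, by simp [Algebra.TensorProduct.algebraMap_apply]⟩
  rw [Algebra.smul_def]
  exact mul_mem hf ha

/-! ## Weights and the category of integrable modules in category `𝒪` -/

section weights

variable {F : Type*} [Field F] [Algebra ℂ F] {M : Type*} [AddCommGroup M] [Module F M]

/-- The weight space of weight `ω`, for a family of operators `κ h` giving the action of
the `k_h`. -/
def weightSpace (κ : 𝔥 → Module.End F M) (ω : Module.Dual ℚ 𝔥) : Submodule F M where
  carrier := {v | ∀ h, κ h v = algebraMap ℂ F (D.qpow (ω h)) • v}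
  zero_mem' := by intro h; simp
  add_mem' := by intro a b ha hb h; rw [map_add, ha h, hb h, smul_add]
  smul_mem' := by intro c a ha h; rw [map_smul, ha h, smul_comm]

end weights

/-- The `ℂ`-subspace `W`, on which the `k_h` act by the operators `κ h`, is a `U_q(𝔥)`-submodule
which is integrable and belongs to the category `𝒪`. -/
structure InModCartan {M : Type*} [AddCommGroup M] [Module ℂ M]
    (κ : 𝔥 → Module.End ℂ M) (W : Submodule ℂ M) : Prop where
  stable : ∀ h, ∀ w ∈ W, κ h w ∈ W
  independent : iSupIndep fun ω => W ⊓ weightSpace D κ ω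
  iSup_eq : ⨆ ω, W ⊓ weightSpace D κ ω = W
  finite : ∀ ω, FiniteDimensional ℂ ↥(W ⊓ weightSpace D κ ω)
  integrable : ∀ (ω : Module.Dual ℚ 𝔥) (i : I), ∃ R : ℕ, ∀ r : ℕ, R ≤ r →
    W ⊓ weightSpace D κ (ω + r • D.root i) = ⊥ ∧ W ⊓ weightSpace D κ (ω - r • D.root i) = ⊥
  bounded : ∃ S : Finset (Module.Dual ℚ 𝔥), ∀ ω, W ⊓ weightSpace D κ ω ≠ ⊥ →
    ∃ lam ∈ S, D.Dominates lam ω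

/-- The category `Mod(U_q(ĝ))`: the `U_q(ĝ)`-modules which, as `U_q(𝔥)`-modules, are integrable and
in the category `𝒪`. -/
def InModUq (M : Type*) [AddCommGroup M] [Module ℂ M] [Module (Uq D) M]
    [IsScalarTower ℂ (Uq D) M] : Prop :=
  InModCartan D (fun h => Algebra.lsmul ℂ ℂ M (Uq.k D h)) ⊤

/-! ## The category `Mod(U'_q(ĝ))` -/

/-- An `(l,u)`-weight `(λ, Ψ)`; the entry `Ψ ε i m` is `Ψ^ε_{i, ε m}(u)`. -/
structure LUWeight where
  wt : Module.Dual ℚ 𝔥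
  Ψ : ℤˣ → I → ℕ → laurentRing
  Ψ_zero : ∀ ε i, Ψ ε i 0 =
    algebraMap ℂ laurentRing (D.qpow (((ε : ℤ) : ℚ) * (D.r i : ℚ) * wt (D.coroot i)))

section modules

variable (M : Type*) [AddCommGroup M] [Module (UqCu D) M] [Module Cu M]
  [IsScalarTower Cu (UqCu D) M]

/-- The action of an element of `U_q(ĝ)` on a `U'_q(ĝ)`-module, as a `ℂ(u)`-linear map. -/
def act (a : Uq D) : Module.End Cu M := Algebra.lsmul Cu Cu M (incl D a)

/-- The weight spaces of a `U'_q(ĝ)`-module; they are `ℂ(u)`-subspaces. -/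
def weightSpaceCu (ω : Module.Dual ℚ 𝔥) : Submodule Cu M :=
  weightSpace D (fun h => act D M (Uq.k D h)) ω

/-- The `(l,u)`-weight space `V_{(λ, Ψ)}`. -/
def luWeightSpace (Λ : LUWeight D) : Submodule Cu M where
  carrier := {v | v ∈ weightSpaceCu D M Λ.wt ∧ ∃ p : ℕ, ∀ (ε : ℤˣ) (i : I) (m : ℕ),
    ((act D M (Uq.phi D ε i ((ε : ℤ) * m)) -
      algebraMap Cu (Module.End Cu M) (Λ.Ψ ε i m : Cu)) ^ p) v = 0}
  zero_mem' := ⟨zero_mem _, 0, fun _ _ _ => map_zero _⟩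
  add_mem' := by
    rintro a b ⟨ha, p, hp⟩ ⟨hb, p', hp'⟩
    refine ⟨add_mem ha hb, p' + p, fun ε i m => ?_⟩
    rw [map_add]
    conv_lhs => enter [2]; rw [add_comm p' p]
    rw [pow_add, pow_add, Module.End.mul_apply, Module.End.mul_apply, hp, hp', map_zero, map_zero,
      add_zero]
  smul_mem' := by
    rintro c a ⟨ha, p, hp⟩
    exact ⟨Submodule.smul_mem _ c ha, p, fun ε i m => by rw [map_smul, hp, smul_zero]⟩

variable [Module ℂ M] [IsScalarTower ℂ Cu M] [IsScalarTower ℂ (UqCu D) M]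

/-- The action of `k_h` on a `U'_q(ĝ)`-module, as a `ℂ`-linear map. -/
def kActC (h : 𝔥) : Module.End ℂ M := Algebra.lsmul ℂ ℂ M (incl D (Uq.k D h))

variable {M} in
/-- The conditions relating a `U'_q(ĝ)`-module `M` and a `ℂ`-subspace `W` of `M`. -/
structure IsGenerating (W : Submodule ℂ M) : Prop where
  /-- The multiplication map `ℂ(u) ⊗ W → M` is an isomorphism. -/
  bijective : Function.Bijective (LinearMap.liftBaseChange Cu W.subtype)
  /-- `W` is stable under `U_q(𝔥)` and belongs to `Mod(U_q(𝔥))`. -/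
  cartan : InModCartan D (kActC D M) W
  /-- The image of `ℂ[u, u⁻¹] ⊗ W` in `M` is stable under `U_q(ĥ)`. -/
  lattice_stable : ∀ a ∈ UqCartan D, ∀ w ∈ Submodule.span laurentRing (W : Set M),
    incl D a • w ∈ Submodule.span laurentRing (W : Set M)
  /-- On each weight space of `W`, the operators `x^±_{i, r ± m}` (`m ≥ 0`) are a finite sum
  `∑ λ ^ m u ^ (k m) m ^ k' f_{k, k', λ}` with `k, k' ≥ 0` and `λ ≠ 0`. -/
  regular : ∀ (ω : Module.Dual ℚ 𝔥) (ε : ℤˣ) (i : I) (r : ℤ),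
    ∃ (S : Finset (ℕ × ℕ × ℂˣ))
      (f : ℕ × ℕ × ℂˣ → (↥(W ⊓ weightSpace D (kActC D M) ω) →ₗ[ℂ] M)),
      ∀ (m : ℕ) (w : ↥(W ⊓ weightSpace D (kActC D M) ω)),
        incl D (Uq.x D ε i (r + (ε : ℤ) * m)) • (w : M) =
          ∑ t ∈ S, (algebraMap ℂ Cu ((t.2.2 : ℂ) ^ m) * (RatFunc.X : Cu) ^ (t.1 * m) *
            (m : Cu) ^ t.2.1) • f t w

/-- The category `Mod(U'_q(ĝ))`. -/
structure InModUqCu : Prop where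
  exists_generating : ∃ W : Submodule ℂ M, IsGenerating D W
  lu_independent : iSupIndep (luWeightSpace D M)
  lu_iSup : ⨆ Λ, luWeightSpace D M Λ = ⊤

end modules

/-! ## `𝒜`-forms and their specialization -/

section forms

variable {M : Type*} [AddCommGroup M] [Module (UqCu D) M] [Module Cu M]
  [IsScalarTower Cu (UqCu D) M]

instance (L : Submodule 𝒜 M) : Module 𝒜 L := L.module

instance (L : Submodule 𝒜 M) : SMul 𝒜 L := (L.module).toSMul

variable (M) in
/-- `L` is an `𝒜`-form of the `U'_q(ĝ)`-module `M`. -/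
structure IsAForm (L : Submodule 𝒜 M) : Prop where
  stable : ∀ a ∈ UqA D, ∀ x ∈ L, a • x ∈ L
  span_eq : Submodule.span Cu (L : Set M) = ⊤
  fg : ∀ lam : Module.Dual ℚ 𝔥, (L ⊓ (weightSpaceCu D M lam).restrictScalars 𝒜).FG

variable {L : Submodule 𝒜 M} (hL : IsAForm D M L)

/-- The specialization `L / (u - 1) L` of an `𝒜`-form `L` at `u = 1`. -/
def Spec1 (_hL : IsAForm D M L) : Type _ := L ⧸ LinearMap.range (LinearMap.lsmul 𝒜 L uSubOne)

namespace Spec1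

instance : AddCommGroup (Spec1 D hL) :=
  inferInstanceAs (AddCommGroup (L ⧸ LinearMap.range (LinearMap.lsmul 𝒜 L uSubOne)))

instance : Module 𝒜 (Spec1 D hL) :=
  inferInstanceAs (Module 𝒜 (L ⧸ LinearMap.range (LinearMap.lsmul 𝒜 L uSubOne)))

/-- The class in `L / (u - 1) L` of an element of `L`. -/
def mk : L →ₗ[𝒜] Spec1 D hL := Submodule.mkQ _

/-- The action of an element of `U_q(ĝ)` on an `𝒜`-form. -/
def actForm (a : Uq D) : L →ₗ[𝒜] L where
  toFun x := ⟨incl D a • (x : M), hL.stable _ (incl_mem_UqA D a) _ x.2⟩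
  map_add' _ _ := Subtype.ext (smul_add _ _ _)
  map_smul' f x := Subtype.ext (smul_comm (incl D a) (f : Cu) (x : M))

/-- The action of `U_q(ĝ)` on the specialization: `a • [x] = [a • x]`. -/
def actSpec : Uq D →+* Module.End 𝒜 (Spec1 D hL) where
  toFun a := Submodule.mapQ _ _ (actForm D hL a) (by
    rintro _ ⟨x, rfl⟩
    exact ⟨actForm D hL a x, by simp⟩)
  map_one' := by
    refine Submodule.linearMap_qext _ (LinearMap.ext fun x => ?_)
    exact congrArg (mk D hL) (Subtype.ext (by simp [actForm]))
  map_mul' a b := by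
    refine Submodule.linearMap_qext _ (LinearMap.ext fun x => ?_)
    exact congrArg (mk D hL) (Subtype.ext (by simp [actForm, mul_smul]))
  map_zero' := by
    refine Submodule.linearMap_qext _ (LinearMap.ext fun x => ?_)
    exact congrArg (mk D hL) (Subtype.ext (by simp [actForm]))
  map_add' a b := by
    refine Submodule.linearMap_qext _ (LinearMap.ext fun x => ?_)
    exact congrArg (mk D hL) (Subtype.ext (by simp [actForm, add_smul]))

instance : Module (Uq D) (Spec1 D hL) := Module.compHom _ (actSpec D hL)

instance : Module ℂ (Spec1 D hL) := Module.compHom _ (algebraMap ℂ (Uq D))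

instance : IsScalarTower ℂ (Uq D) (Spec1 D hL) where
  smul_assoc c a m := by
    rw [Algebra.smul_def, mul_smul]; rfl

lemma smul_mk (a : Uq D) (x : L) : a • mk D hL x = mk D hL (actForm D hL a x) := rfl

end Spec1

end forms

section cyclic

variable {V : Type*} [AddCommGroup V] [Module (UqCu D) V]

/-- The submodule `U'_q(ĝ).v`. -/
abbrev cyc (v : V) : Submodule (UqCu D) V := Submodule.span (UqCu D) {v}

/-- `v` as an element of `U'_q(ĝ).v`. -/
def cycGen (v : V) : cyc D v := ⟨v, Submodule.mem_span_singleton_self v⟩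

variable [Module Cu V] [IsScalarTower Cu (UqCu D) V]

/-- The `𝒜`-submodule `U^u_q(ĝ).v` of `U'_q(ĝ).v`. -/
def cycForm (v : V) : Submodule 𝒜 (cyc D v) where
  carrier := {x | ∃ a ∈ UqA D, a • cycGen D v = x}
  zero_mem' := ⟨0, zero_mem _, zero_smul _ _⟩
  add_mem' := by
    rintro _ _ ⟨a, ha, rfl⟩ ⟨b, hb, rfl⟩
    exact ⟨a + b, add_mem ha hb, add_smul _ _ _⟩
  smul_mem' := by
    rintro f _ ⟨a, ha, rfl⟩
    exact ⟨(f : Cu) • a, smul_mem_UqA D f ha, smul_assoc (f : Cu) a (cycGen D v)⟩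

/-- `v` as an element of `U^u_q(ĝ).v`. -/
def cycFormGen (v : V) : cycForm D v := ⟨cycGen D v, 1, one_mem _, one_smul _ _⟩

end cyclic

end QAff

end

/-!
Write `V ≅ W ⊗ ℂ(u)`, with `W` as in the definition of `Mod(U'_q(ĝ))`. By the triangular
decomposition, `U_q(ĝ)` is spanned by the products of a word in the `x^-_{i, r}`, an element of
`U_q(ĥ)` and a word in the `x^+_{i, r}`, so it suffices to control the orbits of these three factors
on weight vectors.

The sequence `r ↦ x^±_{i, r} w` is an exponential polynomial, whose exponents `λ u ^ k` are units of
`𝒜`. Hence it satisfies a linear recurrence over `𝒜` whose extreme coefficients are units, and its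
values span a finitely generated `𝒜`-module. Similarly `U_q(ĥ)` preserves the
`ℂ[u, u⁻¹]`-lattice spanned by `W`, whose weight parts are of finite rank. Since the weights of `V`
are bounded above, words in the `x^+_{i, r}` of large length kill a given weight vector, and only
finitely many index sequences of words in the `x^-_{i, r}` lead to a given weight. Therefore
the weight parts of `U^u_q(ĝ).v` are finitely generated over `𝒜`.

A submodule `N` of `V` inherits a generating subspace: the weight parts of its intersection with the
lattice are finitely generated and torsion-free over the principal ideal domain `ℂ[u, u⁻¹]`, hence
free, and the `ℂ`-span of bases of them generates `N`. Finally, the specialization is nonzero by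
Nakayama's lemma, applied to the weight parts over the local ring `𝒜`.
-/

namespace QAff

open Subalgebra (toSubmodule)

/-! ## The rings `ℂ[u, u⁻¹]` and `𝒜` -/

lemma isPrincipalIdealRing_of_isLocalization {R : Type*} (S : Type*) [CommRing R] [CommRing S]
    [Algebra R S] (M : Submonoid R) [IsLocalization M S] [IsPrincipalIdealRing R] :
    IsPrincipalIdealRing S where
  principal J := by
    obtain ⟨p, hp⟩ := (IsPrincipalIdealRing.principal (J.under R)).principal
    refine ⟨algebraMap R S p, ?_⟩
    rw [← IsLocalization.map_under M S J, hp, Ideal.submodule_span_eq, Ideal.map_span,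
      Set.image_singleton]

lemma isLocalization_of_exists_fraction {R S : Type*} [CommRing R] [CommRing S] [Algebra R S]
    {M : Submonoid R} (hinj : Function.Injective (algebraMap R S))
    (hunit : ∀ g ∈ M, IsUnit (algebraMap R S g))
    (hfrac : ∀ x : S, ∃ f, ∃ g ∈ M, x * algebraMap R S g = algebraMap R S f) :
    IsLocalization M S where
  map_units g := hunit g g.2
  surj x := by
    obtain ⟨f, g, hg, h⟩ := hfrac x
    exact ⟨(f, ⟨g, hg⟩), h⟩
  exists_of_eq h := ⟨1, by rw [hinj h]⟩

section Rings

open Polynomial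

lemma algebraMap_ne_zero_of_eval_ne_zero {p : ℂ[X]} {z : ℂ} (hp : p.eval z ≠ 0) :
    algebraMap ℂ[X] Cu p ≠ 0 :=
  (map_ne_zero_iff _ (RatFunc.algebraMap_injective ℂ)).2 fun h => hp (by rw [h, eval_zero])

/-- The ideal `(u - 1)` of `ℂ[u]`. -/
noncomputable def vanishingIdealOne : Ideal ℂ[X] := Ideal.span {X - C 1}

lemma mem_vanishingIdealOne {f : ℂ[X]} : f ∈ vanishingIdealOne ↔ f.eval 1 = 0 :=
  Ideal.mem_span_singleton.trans dvd_iff_isRoot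

instance : vanishingIdealOne.IsMaximal :=
  PrincipalIdealRing.isMaximal_of_irreducible (irreducible_X_sub_C 1)

noncomputable instance : Algebra ℂ[X] 𝒜 :=
  ((algebraMap ℂ[X] Cu).codRestrict 𝒜.toSubring fun f =>
    show algebraMap ℂ[X] Cu f ∈ 𝒜 from ⟨f, 1, by simp, by simp⟩).toAlgebra

instance : IsScalarTower ℂ[X] 𝒜 Cu := .of_algebraMap_eq fun _ => rfl

instance : IsLocalization.AtPrime 𝒜 vanishingIdealOne := by
  refine isLocalization_of_exists_fraction ?_ (fun g hg => ?_) ?_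
  · exact fun f g h => RatFunc.algebraMap_injective ℂ (congrArg Subtype.val h)
  · have hg1 : g.eval 1 ≠ 0 := fun h => hg (mem_vanishingIdealOne.2 h)
    exact .of_mul_eq_one ⟨(algebraMap _ Cu g)⁻¹, 1, g, hg1, by simp⟩
      (Subtype.ext (mul_inv_cancel₀ (algebraMap_ne_zero_of_eval_ne_zero hg1)))
  · rintro ⟨_, f, g, hg, rfl⟩
    exact ⟨f, g, fun h => hg (mem_vanishingIdealOne.1 h),
      Subtype.ext (div_mul_cancel₀ _ (algebraMap_ne_zero_of_eval_ne_zero hg))⟩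

instance : IsLocalRing 𝒜 := IsLocalization.AtPrime.isLocalRing 𝒜 vanishingIdealOne

instance : IsPrincipalIdealRing 𝒜 :=
  isPrincipalIdealRing_of_isLocalization 𝒜 vanishingIdealOne.primeCompl

lemma algebraMap_X_sub_C_one : algebraMap ℂ[X] 𝒜 (X - C 1) = uSubOne :=
  Subtype.ext <| by
    change algebraMap ℂ[X] Cu (X - C 1) = RatFunc.X - 1
    simp

lemma uSubOne_ne_zero : (uSubOne : Cu) ≠ 0 := by
  rw [← algebraMap_X_sub_C_one]
  exact algebraMap_ne_zero_of_eval_ne_zero (z := 0) (by simp)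

lemma maximalIdeal_𝒜 : IsLocalRing.maximalIdeal 𝒜 = Ideal.span {uSubOne} := by
  rw [← IsLocalization.AtPrime.map_eq_maximalIdeal vanishingIdealOne 𝒜, vanishingIdealOne,
    Ideal.map_span, Set.image_singleton, algebraMap_X_sub_C_one]

lemma exists_eq_algebraMap_add_uSubOne_mul (x : 𝒜) :
    ∃ (c : ℂ) (y : 𝒜), x = algebraMap ℂ 𝒜 c + uSubOne * y := by
  obtain ⟨f, hf⟩ : ∃ f : ℂ[X], x - algebraMap ℂ[X] 𝒜 f ∈ IsLocalRing.maximalIdeal 𝒜 := by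
    obtain ⟨f, hf⟩ := (IsLocalization.AtPrime.equivQuotMaximalIdeal vanishingIdealOne
      𝒜).surjective (Ideal.Quotient.mk _ x)
    obtain ⟨f, rfl⟩ := Ideal.Quotient.mk_surjective f
    exact ⟨f, Ideal.Quotient.eq.1 hf.symm⟩
  obtain ⟨g, hg⟩ : X - C 1 ∣ f - C (f.eval 1) := dvd_iff_isRoot.2 (by simp)
  rw [maximalIdeal_𝒜, Ideal.mem_span_singleton] at hf
  obtain ⟨y, hy⟩ := hf
  refine ⟨f.eval 1, y + algebraMap ℂ[X] 𝒜 g, ?_⟩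
  have hfg : algebraMap ℂ[X] 𝒜 f - algebraMap ℂ 𝒜 (f.eval 1) =
      uSubOne * algebraMap ℂ[X] 𝒜 g := by
    rw [← algebraMap_X_sub_C_one, ← map_mul, ← hg, map_sub]
    rfl
  linear_combination hy + hfg

lemma exists_unit_coe_eq_X : ∃ z : 𝒜ˣ, ((z : 𝒜) : Cu) = RatFunc.X := by
  obtain ⟨z, hz⟩ := IsLocalization.map_units 𝒜
    (⟨X, fun h => by simpa using mem_vanishingIdealOne.1 h⟩ : vanishingIdealOne.primeCompl)
  exact ⟨z, by rw [hz]; exact RatFunc.algebraMap_X⟩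

noncomputable instance : Algebra ℂ[X] laurentRing :=
  (aeval (⟨RatFunc.X, Algebra.subset_adjoin (by simp)⟩ : laurentRing)).toAlgebra

instance : IsScalarTower ℂ[X] laurentRing Cu := by
  refine .of_algebraMap_eq fun f => ?_
  have h : laurentRing.val.comp (aeval ⟨RatFunc.X, Algebra.subset_adjoin (by simp)⟩) =
      IsScalarTower.toAlgHom ℂ ℂ[X] Cu := algHom_ext (by simp)
  exact (DFunLike.congr_fun h f).symm

lemma exists_mul_X_pow_eq_algebraMap {x : Cu} (hx : x ∈ laurentRing) :
    ∃ (f : ℂ[X]) (n : ℕ), x * RatFunc.X ^ n = algebraMap _ Cu f := by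
  induction hx using Algebra.adjoin_induction with
  | mem x hx =>
    rcases hx with rfl | rfl
    · exact ⟨X, 0, by simp⟩
    · exact ⟨1, 1, by simp [RatFunc.X_ne_zero]⟩
  | algebraMap c => exact ⟨C c, 0, by rw [pow_zero, mul_one]; rfl⟩
  | add x y _ _ hx hy =>
    obtain ⟨f, n, hf⟩ := hx
    obtain ⟨g, m, hg⟩ := hy
    refine ⟨f * X ^ m + g * X ^ n, n + m, ?_⟩
    simp only [map_add, map_mul, map_pow, RatFunc.algebraMap_X, ← hf, ← hg]
    ring
  | mul x y _ _ hx hy =>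
    obtain ⟨f, n, hf⟩ := hx
    obtain ⟨g, m, hg⟩ := hy
    refine ⟨f * g, n + m, ?_⟩
    simp only [map_mul, ← hf, ← hg]
    ring

instance : IsLocalization.Away (X : ℂ[X]) laurentRing := by
  have hcoe (f : ℂ[X]) : (algebraMap ℂ[X] laurentRing f : Cu) = algebraMap ℂ[X] Cu f :=
    (IsScalarTower.algebraMap_apply ℂ[X] laurentRing Cu f).symm
  refine isLocalization_of_exists_fraction (fun f g h => ?_) ?_ fun x => ?_
  · exact RatFunc.algebraMap_injective ℂ (by rw [← hcoe, h, hcoe])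
  · rintro _ ⟨n, rfl⟩
    have hX : IsUnit (algebraMap ℂ[X] laurentRing X) := by
      refine .of_mul_eq_one ⟨RatFunc.X⁻¹, Algebra.subset_adjoin (by simp)⟩ (Subtype.ext ?_)
      change (algebraMap ℂ[X] laurentRing X : Cu) * _ = 1
      rw [hcoe, RatFunc.algebraMap_X]
      exact mul_inv_cancel₀ RatFunc.X_ne_zero
    simpa only [map_pow] using hX.pow n
  · obtain ⟨f, n, hf⟩ := exists_mul_X_pow_eq_algebraMap x.2
    refine ⟨f, X ^ n, ⟨n, rfl⟩, Subtype.ext ?_⟩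
    change (x : Cu) * (algebraMap ℂ[X] laurentRing _ : Cu) = _
    rw [hcoe, hcoe, ← hf, map_pow, RatFunc.algebraMap_X]

instance : IsPrincipalIdealRing laurentRing :=
  isPrincipalIdealRing_of_isLocalization laurentRing (Submonoid.powers (X : ℂ[X]))

instance : IsFractionRing laurentRing Cu :=
  IsFractionRing.isFractionRing_of_isDomain_of_isLocalization (Submonoid.powers (X : ℂ[X])) _ _

lemma laurentRing_le_𝒜 : laurentRing ≤ 𝒜 := by
  refine Algebra.adjoin_le ?_
  rintro x (rfl | rfl)
  · exact ⟨X, 1, by simp, by simp⟩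
  · exact ⟨1, X, by simp, by simp⟩

end Rings

/-! ## Simultaneous generalized eigenspaces and weight spaces -/

lemma inf_iSup_eq_of_iSupIndep {α ι : Type*} [CompleteLattice α] [IsModularLattice α]
    {A B : ι → α} (hA : iSupIndep A) (hBA : B ≤ A) (i : ι) : A i ⊓ ⨆ j, B j = B i := by
  refine le_antisymm ?_ (le_inf (hBA i) (le_iSup B i))
  have hdisj : A i ⊓ ⨆ (j) (_ : j ≠ i), B j = ⊥ :=
    ((hA i).mono_right (iSup₂_mono fun j _ => hBA j)).eq_bot
  rw [iSup_split_single B i, inf_comm, sup_inf_assoc_of_le _ (hBA i), inf_comm, hdisj, sup_bot_eq]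

section JointEigenspaces

variable {K M κ : Type*} [Field K] [AddCommGroup M] [Module K M]

/-- The simultaneous generalized eigenspace of a family of operators, which need not commute, for
the family `χ` of eigenvalues. -/
def jointGenEigenspace (T : κ → Module.End K M) (χ : κ → K) : Submodule K M :=
  ⨅ k, (T k).maxGenEigenspace (χ k)

lemma mem_jointGenEigenspace {T : κ → Module.End K M} {χ : κ → K} {v : M} :
    v ∈ jointGenEigenspace T χ ↔ ∀ k, ∃ p : ℕ, ((T k - χ k • 1) ^ p) v = 0 := by
  simp only [jointGenEigenspace, Submodule.mem_iInf, Module.End.mem_maxGenEigenspace]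

lemma iSupIndep_jointGenEigenspace (T : κ → Module.End K M) :
    iSupIndep (jointGenEigenspace T) := by
  classical
  rw [iSupIndep_iff_finsetSum_eq_zero_imp_eq_zero]
  intro S
  induction S using Finset.strongInduction with
  | H S ih =>
    intro v hv hsum χ hχ
    by_cases hS : ∀ ψ ∈ S, ψ = χ
    · rwa [Finset.eq_singleton_iff_unique_mem.2 ⟨hχ, hS⟩, Finset.sum_singleton] at hsum
    push Not at hS
    obtain ⟨ψ, hψ, hne⟩ := hS
    obtain ⟨k, hk⟩ := Function.ne_iff.1 hne
    have hfiber : ∑ ψ ∈ S with ψ k = χ k, v ψ = 0 := by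
      refine (iSupIndep_iff_finsetSum_eq_zero_imp_eq_zero _).1 (T k).independent_maxGenEigenspace
        (S.image fun ψ => ψ k) (fun b => ∑ ψ ∈ S with ψ k = b, v ψ)
        (fun b _ => sum_mem fun ψ hψ => ?_) ?_ _ (Finset.mem_image_of_mem _ hχ)
      · obtain ⟨hψS, rfl⟩ := Finset.mem_filter.1 hψ
        exact Submodule.mem_iInf _ |>.1 (hv ψ hψS) k
      · rwa [Finset.sum_fiberwise_of_maps_to (g := fun ψ : κ → K => ψ k)
          fun ψ => Finset.mem_image_of_mem _]
    exact ih _ (Finset.filter_ssubset.2 ⟨ψ, hψ, hk⟩) v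
      (fun ψ hψ => hv ψ (Finset.mem_filter.1 hψ).1) hfiber χ (Finset.mem_filter.2 ⟨hχ, rfl⟩)

lemma map_mkQ_jointGenEigenspace_le {T : κ → Module.End K M} {N : Submodule K M}
    (hN : ∀ k, N ≤ N.comap (T k)) (χ : κ → K) :
    (jointGenEigenspace T χ).map N.mkQ ≤
      jointGenEigenspace (fun k => N.mapQ N (T k) (hN k)) χ := by
  rintro _ ⟨v, hv, rfl⟩
  rw [SetLike.mem_coe, mem_jointGenEigenspace] at hv
  refine mem_jointGenEigenspace.2 fun k => ?_
  obtain ⟨p, hp⟩ := hv k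
  have hcomm (p : ℕ) (v : M) : ((N.mapQ N (T k) (hN k) - χ k • 1) ^ p) (N.mkQ v) =
      N.mkQ (((T k - χ k • 1) ^ p) v) := by
    induction p generalizing v with
    | zero => rfl
    | succ p ih => rw [pow_succ, pow_succ, Module.End.mul_apply, Module.End.mul_apply, ← ih]; rfl
  exact ⟨p, by rw [hcomm, hp, map_zero]⟩

lemma inf_iSup_eq_of_le_jointGenEigenspace {ι : Type*} {T : κ → Module.End K M}
    {N : Submodule K M} (hN : ∀ k, N ≤ N.comap (T k)) {χ : ι → κ → K}
    (hχ : Function.Injective χ) {A : ι → Submodule K M}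
    (hA : ∀ i, A i ≤ jointGenEigenspace T (χ i)) : N ⊓ ⨆ i, A i = ⨆ i, N ⊓ A i := by
  refine le_antisymm ?_ (iSup_le fun i => inf_le_inf_left N (le_iSup A i))
  rintro x ⟨hxN, hx⟩
  obtain ⟨f, hf, rfl⟩ := (Submodule.mem_iSup_iff_exists_finsupp _ _).1 hx
  have hquot : ∀ i ∈ f.support, N.mkQ (f i) = 0 := by
    refine (iSupIndep_iff_finsetSum_eq_zero_imp_eq_zero _).1
      ((iSupIndep_jointGenEigenspace fun k => N.mapQ N (T k) (hN k)).comp hχ) f.support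
      (fun i => N.mkQ (f i))
      (fun i _ => map_mkQ_jointGenEigenspace_le hN _ (Submodule.mem_map_of_mem (hA i (hf i)))) ?_
    rw [← map_sum]
    exact (Submodule.Quotient.mk_eq_zero N).2 hxN
  exact sum_mem fun i hi => Submodule.mem_iSup_of_mem i
    ⟨(Submodule.Quotient.mk_eq_zero N).1 (hquot i hi), hf i⟩

end JointEigenspaces

variable {I : Type*} [Fintype I] [DecidableEq I] {𝔥 : Type*} [AddCommGroup 𝔥] [Module ℚ 𝔥]
  (D : Datum I 𝔥)

namespace Datum

lemma qpow_ne_zero (s : ℚ) : D.qpow s ≠ 0 := Complex.exp_ne_zero _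

lemma qpow_add (s t : ℚ) : D.qpow (s + t) = D.qpow s * D.qpow t := by
  rw [qpow, Rat.cast_add, add_mul, Complex.exp_add]; rfl

lemma qpow_nsmul (n : ℕ) (s : ℚ) : D.qpow (n * s) = D.qpow s ^ n := by
  rw [qpow, qpow, ← Complex.exp_nat_mul, Rat.cast_mul, Rat.cast_natCast, mul_assoc]

lemma qpow_ne_one {s : ℚ} (hs : s ≠ 0) : D.qpow s ≠ 1 := by
  intro h
  have hnum : D.qpow s.num = 1 := by
    rw [← Rat.den_mul_eq_num, qpow_nsmul, h, one_pow]
  rw [qpow, Rat.cast_intCast, Complex.exp_int_mul] at hnum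
  have hnatAbs : Complex.exp D.logq ^ s.num.natAbs = 1 := by
    rcases Int.natAbs_eq s.num with h | h <;> rw [h] at hnum
    · exact_mod_cast hnum
    · rwa [zpow_neg, inv_eq_one, zpow_natCast] at hnum
  exact D.not_root_of_unity _ (Int.natAbs_pos.2 (Rat.num_ne_zero.2 hs)) hnatAbs

lemma qpow_injective : Function.Injective D.qpow := by
  intro s t h
  by_contra hst
  refine D.qpow_ne_one (sub_ne_zero.2 hst) (mul_right_cancel₀ (D.qpow_ne_zero t) ?_)
  rw [← qpow_add, sub_add_cancel, h, one_mul]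

end Datum

section WeightSpaces

variable {F : Type*} [Field F] [Algebra ℂ F] {M : Type*} [AddCommGroup M] [Module F M]

lemma weight_eigenvalues_injective : Function.Injective
    fun (ω : Module.Dual ℚ 𝔥) (h : 𝔥) => algebraMap ℂ F (D.qpow (ω h)) := fun _ _ heq =>
  LinearMap.ext fun h => D.qpow_injective ((algebraMap ℂ F).injective (congrFun heq h))

lemma weightSpace_le_jointGenEigenspace (κ : 𝔥 → Module.End F M) (ω : Module.Dual ℚ 𝔥) :
    weightSpace D κ ω ≤ jointGenEigenspace κ fun h => algebraMap ℂ F (D.qpow (ω h)) :=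
  fun _ hv => mem_jointGenEigenspace.2 fun h =>
    ⟨1, by rw [pow_one, LinearMap.sub_apply, hv h]; exact sub_self _⟩

lemma iSupIndep_weightSpace (κ : 𝔥 → Module.End F M) : iSupIndep (weightSpace D κ) :=
  ((iSupIndep_jointGenEigenspace κ).comp (weight_eigenvalues_injective D)).mono
    (weightSpace_le_jointGenEigenspace D κ)

lemma inf_iSup_weightSpace {κ : 𝔥 → Module.End F M} {N : Submodule F M}
    (hN : ∀ h, N ≤ N.comap (κ h)) : N ⊓ ⨆ ω, weightSpace D κ ω = ⨆ ω, N ⊓ weightSpace D κ ω :=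
  inf_iSup_eq_of_le_jointGenEigenspace hN (weight_eigenvalues_injective D)
    (weightSpace_le_jointGenEigenspace D κ)

end WeightSpaces

/-! ## The triangular decomposition -/

section PowerSeries

open PowerSeries (coeff)

lemma coeff_pow_mem {A σ : Type*} [Semiring A] [SetLike σ A] [SubsemiringClass σ A] {S : σ}
    {H : PowerSeries A} {m : ℕ} (hH : ∀ j < m, coeff j H ∈ S) (n : ℕ) :
    ∀ j < m, coeff j (H ^ n) ∈ S := by
  induction n with
  | zero =>
    intro j _
    rw [pow_zero, PowerSeries.coeff_one]
    split_ifs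
    exacts [one_mem _, zero_mem _]
  | succ n ih =>
    intro j hj
    rw [pow_succ, PowerSeries.coeff_mul]
    refine sum_mem fun p hp => ?_
    have := Finset.HasAntidiagonal.mem_antidiagonal.1 hp
    exact mul_mem (ih _ (by lia)) (hH _ (by lia))

lemma coeff_pow_add_two_mem {A σ : Type*} [Semiring A] [SetLike σ A] [SubsemiringClass σ A]
    {S : σ} {H : PowerSeries A} (h0 : coeff 0 H = 0) {m : ℕ} (hH : ∀ j < m, coeff j H ∈ S)
    (n : ℕ) : coeff m (H ^ (n + 2)) ∈ S := by
  have hpow : coeff 0 (H ^ (n + 1)) = 0 := by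
    rw [PowerSeries.coeff_zero_eq_constantCoeff_apply] at h0 ⊢
    rw [pow_succ, map_mul, h0, mul_zero]
  rw [pow_succ, PowerSeries.coeff_mul]
  refine sum_mem fun ⟨a, b⟩ hab => ?_
  have := Finset.HasAntidiagonal.mem_antidiagonal.1 hab
  rcases Nat.eq_zero_or_pos b with rfl | hb
  · rw [h0, mul_zero]
    exact zero_mem _
  rcases Nat.eq_zero_or_pos a with rfl | ha
  · rw [hpow, zero_mul]
    exact zero_mem _
  exact mul_mem (coeff_pow_mem hH _ _ (by lia)) (hH _ (by lia))

variable {K A : Type*} [Field K] [Ring A] [Algebra K A]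

variable (K) in
/-- The coefficient of `t ^ m` in `exp H`, for a power series `H` without constant term: the
terms `H ^ n / n!` with `n > m` do not contribute to it. -/
noncomputable def expCoeff (H : PowerSeries A) (m : ℕ) : A :=
  ∑ n ∈ Finset.range (m + 1), ((n.factorial : K)⁻¹) • coeff m (H ^ n)

lemma expCoeff_mem {S : Subalgebra K A} {H : PowerSeries A} (hH : ∀ j, coeff j H ∈ S) (m : ℕ) :
    expCoeff K H m ∈ S :=
  sum_mem fun n _ => S.smul_mem (coeff_pow_mem (fun j _ => hH j) n m m.lt_succ_self) _

lemma expCoeff_succ (H : PowerSeries A) (m : ℕ) : expCoeff K H (m + 1) =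
    ∑ n ∈ Finset.range m, (((n + 2).factorial : K)⁻¹) • coeff (m + 1) (H ^ (n + 2)) +
      coeff (m + 1) H := by
  rw [expCoeff, Finset.sum_range_succ', Finset.sum_range_succ']
  simp [PowerSeries.coeff_one]

lemma coeff_mem_of_expCoeff_mem {S : Subalgebra K A} {H : PowerSeries A} (h0 : coeff 0 H = 0)
    (hH : ∀ m, expCoeff K H m ∈ S) (m : ℕ) : coeff m H ∈ S := by
  induction m using Nat.strong_induction_on with
  | _ m ih =>
    cases m with
    | zero => exact h0 ▸ zero_mem S
    | succ m =>
      rw [← sub_eq_iff_eq_add'.2 (expCoeff_succ (K := K) H m)]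
      exact sub_mem (hH _) (sum_mem fun n _ => S.smul_mem (coeff_pow_add_two_mem h0 ih n) _)

end PowerSeries

section Adjoin

variable {R A : Type*} [CommSemiring R] [Semiring A] [Algebra R A] {s : Set A}
  {Y : Submodule R A}

lemma adjoin_mul_le (h : Submodule.span R s * Y ≤ Y) :
    toSubmodule (Algebra.adjoin R s) * Y ≤ Y := by
  refine Submodule.mul_le.2 fun a (ha : a ∈ Algebra.adjoin R s) => ?_
  induction ha using Algebra.adjoin_induction with
  | mem a ha => exact fun y hy => h (Submodule.mul_mem_mul (Submodule.subset_span ha) hy)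
  | algebraMap c => exact fun y hy => Algebra.smul_def c y ▸ Y.smul_mem c hy
  | add a b _ _ ha hb => exact fun y hy => add_mul a b y ▸ add_mem (ha y hy) (hb y hy)
  | mul a b _ _ ha hb => exact fun y hy => mul_assoc a b y ▸ ha _ (hb y hy)

lemma mul_adjoin_le (h : Y * Submodule.span R s ≤ Y) :
    Y * toSubmodule (Algebra.adjoin R s) ≤ Y := by
  refine Submodule.mul_le.2 fun y hy a (ha : a ∈ Algebra.adjoin R s) => ?_
  induction ha using Algebra.adjoin_induction generalizing y with
  | mem a ha => exact h (Submodule.mul_mem_mul hy (Submodule.subset_span ha))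
  | algebraMap c => exact Algebra.commutes c y ▸ Algebra.smul_def c y ▸ Y.smul_mem c hy
  | add a b _ _ ha hb => exact mul_add y a b ▸ add_mem (ha y hy) (hb y hy)
  | mul a b _ _ ha hb => exact mul_assoc y a b ▸ hb _ (ha y hy)

lemma one_le_toSubmodule (S : Subalgebra R A) : 1 ≤ toSubmodule S :=
  Submodule.one_le.2 S.one_mem

lemma adjoin_mul_le_mul_adjoin
    (h : Submodule.span R s * Y ≤ Y * toSubmodule (Algebra.adjoin R s)) :
    toSubmodule (Algebra.adjoin R s) * Y ≤ Y * toSubmodule (Algebra.adjoin R s) := by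
  set S := toSubmodule (Algebra.adjoin R s)
  have hS : S * S = S := Subalgebra.isIdempotentElem_toSubmodule _
  have hY : Y ≤ Y * S := le_mul_of_one_le_right' (one_le_toSubmodule _)
  refine (mul_le_mul_right hY _).trans (adjoin_mul_le ?_)
  calc Submodule.span R s * (Y * S) = Submodule.span R s * Y * S := (mul_assoc ..).symm
    _ ≤ Y * S * S := mul_le_mul_left h _
    _ = Y * S := by rw [mul_assoc, hS]

lemma mul_adjoin_le_adjoin_mul
    (h : Y * Submodule.span R s ≤ toSubmodule (Algebra.adjoin R s) * Y) :
    Y * toSubmodule (Algebra.adjoin R s) ≤ toSubmodule (Algebra.adjoin R s) * Y := by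
  set S := toSubmodule (Algebra.adjoin R s)
  have hS : S * S = S := Subalgebra.isIdempotentElem_toSubmodule _
  have hY : Y ≤ S * Y := le_mul_of_one_le_left' (one_le_toSubmodule _)
  refine (mul_le_mul_left hY _).trans (mul_adjoin_le ?_)
  calc S * Y * Submodule.span R s = S * (Y * Submodule.span R s) := mul_assoc ..
    _ ≤ S * (S * Y) := mul_le_mul_right h _
    _ = S * Y := by rw [← mul_assoc, hS]

end Adjoin

namespace Uq

variable {D} in
lemma proj_eq_of_rel {a b : Free I 𝔥} (h : Rel D a b) : proj D a = proj D b :=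
  RingQuot.mkAlgHom_rel ℂ h

lemma k_mul_k (h h' : 𝔥) : k D h * k D h' = k D (h + h') := by
  simpa only [map_mul, k] using proj_eq_of_rel (Rel.k_add (D := D) h h')

lemma k_zero : k D 0 = 1 := by
  simpa only [map_one, k] using proj_eq_of_rel (Rel.k_zero (D := D))

lemma k_mul_x (h : 𝔥) (ε : ℤˣ) (j : I) (r : ℤ) :
    k D h * x D ε j r = D.qpow (((ε : ℤ) : ℚ) * D.root j h) • (x D ε j r * k D h) := by
  simpa only [map_mul, map_smul, k, x] using proj_eq_of_rel (Rel.k_x (D := D) h ε j r)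

lemma x_one_mul_x_neg_one (i j : I) (r s : ℤ) : x D 1 i r * x D (-1) j s =
    x D (-1) j s * x D 1 i r + if i = j then
      (D.qi i - (D.qi i)⁻¹)⁻¹ • (phi D 1 i (r + s) - phi D (-1) i (r + s)) else 0 := by
  have h := proj_eq_of_rel (Rel.x_plus_x_minus (D := D) i j r s)
  rw [map_sub, map_mul, map_mul, sub_eq_iff_eq_add', apply_ite (proj D), map_smul, map_sub,
    map_zero] at h
  exact h

/-- The element `φ^ε_{i, ε m}`. -/
noncomputable def phiN (ε : ℤˣ) (i : I) (m : ℕ) : Uq D := phi D ε i ((ε : ℤ) * m)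

lemma phiN_eq (ε : ℤˣ) (i : I) (m : ℕ) : phiN D ε i m =
    k D (((ε : ℤ) * (D.r i : ℤ)) • D.coroot i) *
      proj D (expCoeff ℂ (hSeries D fh ε i) m) := by
  have h : fphi D ε i ((ε : ℤ) * m) = phiNat D fk fh ε i m := by
    rw [fphi, phiInt, ← mul_assoc, Int.units_coe_mul_self, one_mul, if_pos m.cast_nonneg,
      Int.natAbs_mul, Int.units_natAbs, one_mul, Int.natAbs_natCast]
  rw [phiN, phi, h, phiNat, map_mul]
  rfl

lemma k_mul_phiN (h : 𝔥) (ε : ℤˣ) (i : I) (m : ℕ) :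
    k D h * phiN D ε i m = phiN D ε i m * k D h := by
  simpa only [map_mul, k, phiN, phi] using proj_eq_of_rel (Rel.k_phi (D := D) h ε i ((ε : ℤ) * m))

lemma exists_phiN_mul_x (ε' ε : ℤˣ) (i j : I) : ∃ g : ℕ → ℂ, g 0 ≠ 0 ∧ ∀ (m : ℕ) (r : ℤ),
    phiN D ε' i m * x D ε j r =
      ∑ p ∈ Finset.range (m + 1), g p • (x D ε j (r + ε' * p) * phiN D ε' i (m - p)) := by
  set c := D.qpow ((ε : ℤ) * D.B i j : ℤ)
  have hc : c ≠ 0 := D.qpow_ne_zero _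
  rcases Int.units_eq_one_or ε' with rfl | rfl
  · refine ⟨fun p => PowerSeries.coeff p (gPlus c), by simpa [gPlus] using hc, fun m r => ?_⟩
    have h := proj_eq_of_rel (Rel.phi_plus_x (D := D) ε i j m r)
    simp only [map_mul, map_sum, map_smul] at h
    simp only [phiN, Units.val_one, one_mul, phi, x]
    rw [h]
    refine Finset.sum_congr rfl fun p hp => ?_
    rw [Nat.cast_sub (Nat.lt_succ_iff.1 (Finset.mem_range.1 hp))]
  · refine ⟨fun p => PowerSeries.coeff p (gMinus c), by simpa [gMinus] using hc, fun m r => ?_⟩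
    have h := proj_eq_of_rel (Rel.phi_minus_x (D := D) ε i j m r)
    simp only [map_mul, map_sum, map_smul] at h
    simp only [phiN, Units.val_neg, Units.val_one, neg_one_mul, phi, x]
    rw [h]
    refine Finset.sum_congr rfl fun p hp => ?_
    rw [Nat.cast_sub (Nat.lt_succ_iff.1 (Finset.mem_range.1 hp)), sub_eq_add_neg]

end Uq

/-- The elements `k_h` and `φ^ε_{i, ε m}`, which generate the same subalgebra as the `k_h` and the
`h_{i, m}`. -/
def cartanGens : Set (Uq D) :=
  Set.range (Uq.k D) ∪ Set.range fun p : ℤˣ × I × ℕ => Uq.phiN D p.1 p.2.1 p.2.2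

lemma coeff_zero_hSeries {A : Type*} [Ring A] [Algebra ℂ A] (h : I → {m : ℤ // m ≠ 0} → A)
    (ε : ℤˣ) (i : I) : PowerSeries.coeff 0 (hSeries D h ε i) = 0 := by
  rw [hSeries, PowerSeries.coeff_mk, dif_pos rfl]

lemma k_mem_UqCartan (h : 𝔥) : Uq.k D h ∈ UqCartan D :=
  Algebra.subset_adjoin (.inl ⟨h, rfl⟩)

lemma phiN_mem_UqCartan (ε : ℤˣ) (i : I) (m : ℕ) : Uq.phiN D ε i m ∈ UqCartan D := by
  rw [Uq.phiN_eq]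
  refine mul_mem (k_mem_UqCartan D _)
    (expCoeff_mem (S := (UqCartan D).comap (Uq.proj D)) (fun j => ?_) m)
  rw [hSeries, PowerSeries.coeff_mk]
  split_ifs with hj
  · exact zero_mem _
  · refine Subalgebra.smul_mem _ ?_ _
    exact (Algebra.subset_adjoin (.inr ⟨(i, _), rfl⟩) : Uq.h D i _ ∈ UqCartan D)

lemma h_mem_adjoin_cartanGens (i : I) (m : {m : ℤ // m ≠ 0}) :
    Uq.h D i m ∈ Algebra.adjoin ℂ (cartanGens D) := by
  obtain ⟨m, hm⟩ := m
  obtain ⟨ε, p, hp, rfl⟩ : ∃ (ε : ℤˣ) (p : ℕ), p ≠ 0 ∧ (ε : ℤ) * p = m := by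
    rcases le_total 0 m with h | h
    · exact ⟨1, m.natAbs, by lia, by rw [Units.val_one]; lia⟩
    · exact ⟨-1, m.natAbs, by lia, by rw [Units.val_neg, Units.val_one]; lia⟩
  have hexp (l : ℕ) : expCoeff ℂ (hSeries D fh ε i) l ∈
      (Algebra.adjoin ℂ (cartanGens D)).comap (Uq.proj D) := by
    have h : Uq.k D (-(((ε : ℤ) * (D.r i : ℤ)) • D.coroot i)) * Uq.phiN D ε i l ∈
        Algebra.adjoin ℂ (cartanGens D) :=
      mul_mem (Algebra.subset_adjoin (.inl ⟨_, rfl⟩))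
        (Algebra.subset_adjoin (.inr ⟨(ε, i, l), rfl⟩))
    rwa [Uq.phiN_eq, ← mul_assoc, Uq.k_mul_k, neg_add_cancel, Uq.k_zero, one_mul] at h
  have hcoeff := coeff_mem_of_expCoeff_mem (coeff_zero_hSeries D _ ε i) hexp p
  have hc : ((ε : ℤ) : ℂ) * (D.qpow 1 - D.qpow (-1)) ≠ 0 :=
    mul_ne_zero (by exact_mod_cast ε.ne_zero)
      (sub_ne_zero.2 (D.qpow_injective.ne (by norm_num)))
  rw [hSeries, PowerSeries.coeff_mk, dif_neg hp, Subalgebra.mem_comap, map_smul] at hcoeff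
  exact (Submodule.smul_mem_iff (toSubmodule (Algebra.adjoin ℂ (cartanGens D))) hc).1 hcoeff

lemma adjoin_cartanGens : Algebra.adjoin ℂ (cartanGens D) = UqCartan D := by
  refine le_antisymm (Algebra.adjoin_le ?_) (Algebra.adjoin_le ?_)
  · rintro _ (⟨h, rfl⟩ | ⟨⟨ε, i, m⟩, rfl⟩)
    exacts [k_mem_UqCartan D h, phiN_mem_UqCartan D ε i m]
  · rintro _ (⟨h, rfl⟩ | ⟨⟨i, m⟩, rfl⟩)
    exacts [Algebra.subset_adjoin (.inl ⟨h, rfl⟩), h_mem_adjoin_cartanGens D i m]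

lemma phi_mem_UqCartan (ε : ℤˣ) (i : I) (m : ℤ) : Uq.phi D ε i m ∈ UqCartan D := by
  by_cases h : 0 ≤ (ε : ℤ) * m
  · have hphi := phiN_mem_UqCartan D ε i ((ε : ℤ) * m).toNat
    rwa [Uq.phiN, Int.toNat_of_nonneg h, ← mul_assoc, Int.units_coe_mul_self, one_mul] at hphi
  · rw [Uq.phi, fphi, phiInt, if_neg h, map_zero]
    exact zero_mem _

/-- The elements `x^ε_{i, r}` for a fixed sign `ε`. -/
def xGens (ε : ℤˣ) : Set (Uq D) := Set.range fun p : I × ℤ => Uq.x D ε p.1 p.2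

/-- The subalgebra generated by the `x^ε_{i, r}` for a fixed sign `ε`. -/
def xAlg (ε : ℤˣ) : Subalgebra ℂ (Uq D) := Algebra.adjoin ℂ (xGens D ε)

open Submodule (span subset_span mul_mem_mul)

lemma span_cartanGens_mul_span_xGens_le (ε : ℤˣ) :
    span ℂ (cartanGens D) * span ℂ (xGens D ε) ≤
      span ℂ (xGens D ε) * toSubmodule (UqCartan D) := by
  rw [Submodule.span_mul_span, Submodule.span_le]
  rintro _ ⟨_, ⟨h, rfl⟩ | ⟨⟨ε', i, m⟩, rfl⟩, _, ⟨⟨j, r⟩, rfl⟩, rfl⟩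
  · simp only [Uq.k_mul_x]
    exact Submodule.smul_mem _ _ (mul_mem_mul (subset_span ⟨(j, r), rfl⟩) (k_mem_UqCartan D h))
  · obtain ⟨g, -, hg⟩ := Uq.exists_phiN_mul_x D ε' ε i j
    simp only [hg]
    exact sum_mem fun p _ => Submodule.smul_mem _ _
      (mul_mem_mul (subset_span ⟨(j, _), rfl⟩) (phiN_mem_UqCartan D ε' i _))

lemma x_mul_phiN_mem (ε ε' : ℤˣ) (i j : I) (r : ℤ) (m : ℕ) :
    Uq.x D ε j r * Uq.phiN D ε' i m ∈ toSubmodule (UqCartan D) * span ℂ (xGens D ε) := by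
  obtain ⟨g, hg0, hg⟩ := Uq.exists_phiN_mul_x D ε' ε i j
  induction m using Nat.strong_induction_on generalizing r with
  | _ m ih =>
    have h := hg m r
    rw [Finset.sum_range_succ', Nat.cast_zero, mul_zero, add_zero, Nat.sub_zero] at h
    rw [← Submodule.smul_mem_iff _ hg0, ← sub_eq_iff_eq_add'.2 h]
    refine sub_mem (mul_mem_mul (phiN_mem_UqCartan D ε' i m) (subset_span ⟨(j, r), rfl⟩))
      (sum_mem fun p hp => Submodule.smul_mem _ _ (ih _ ?_ _))
    have := Finset.mem_range.1 hp
    lia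

lemma span_xGens_mul_span_cartanGens_le (ε : ℤˣ) :
    span ℂ (xGens D ε) * span ℂ (cartanGens D) ≤
      toSubmodule (UqCartan D) * span ℂ (xGens D ε) := by
  rw [Submodule.span_mul_span, Submodule.span_le]
  rintro _ ⟨_, ⟨⟨j, r⟩, rfl⟩, _, ⟨h, rfl⟩ | ⟨⟨ε', i, m⟩, rfl⟩, rfl⟩
  · rw [SetLike.mem_coe, ← Submodule.smul_mem_iff _ (D.qpow_ne_zero (((ε : ℤ) : ℚ) * D.root j h))]
    have hX : Uq.x D ε j r ∈ span ℂ (xGens D ε) := subset_span ⟨(j, r), rfl⟩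
    exact Uq.k_mul_x D h ε j r ▸ mul_mem_mul (k_mem_UqCartan D h) hX
  · exact x_mul_phiN_mem D ε ε' i j r m

lemma UqCartan_mul_span_xGens_le (ε : ℤˣ) :
    toSubmodule (UqCartan D) * span ℂ (xGens D ε) ≤
      span ℂ (xGens D ε) * toSubmodule (UqCartan D) := by
  have h := span_cartanGens_mul_span_xGens_le D ε
  rw [← adjoin_cartanGens] at h ⊢
  exact adjoin_mul_le_mul_adjoin h

lemma span_xGens_mul_UqCartan_le (ε : ℤˣ) :
    span ℂ (xGens D ε) * toSubmodule (UqCartan D) ≤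
      toSubmodule (UqCartan D) * span ℂ (xGens D ε) := by
  have h := span_xGens_mul_span_cartanGens_le D ε
  rw [← adjoin_cartanGens] at h ⊢
  exact mul_adjoin_le_adjoin_mul h

lemma span_xGens_le (ε : ℤˣ) : span ℂ (xGens D ε) ≤ toSubmodule (xAlg D ε) :=
  Submodule.span_le.2 Algebra.subset_adjoin

lemma span_xGens_one_mul_span_xGens_neg_one_le :
    span ℂ (xGens D 1) * span ℂ (xGens D (-1)) ≤
      span ℂ (xGens D (-1)) * span ℂ (xGens D 1) ⊔ toSubmodule (UqCartan D) := by
  rw [Submodule.span_mul_span, Submodule.span_le]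
  rintro _ ⟨_, ⟨⟨i, r⟩, rfl⟩, _, ⟨⟨j, s⟩, rfl⟩, rfl⟩
  simp only [Uq.x_one_mul_x_neg_one]
  refine add_mem (Submodule.mem_sup_left (mul_mem_mul (subset_span ⟨(j, s), rfl⟩)
    (subset_span ⟨(i, r), rfl⟩))) (Submodule.mem_sup_right ?_)
  split_ifs
  · exact Submodule.smul_mem _ _ (sub_mem (phi_mem_UqCartan D 1 i _) (phi_mem_UqCartan D (-1) i _))
  · exact zero_mem _

lemma span_xGens_sup_UqCartan_mul_xAlg_le :
    (span ℂ (xGens D 1) ⊔ toSubmodule (UqCartan D)) * toSubmodule (xAlg D (-1)) ≤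
      toSubmodule (xAlg D (-1)) * (span ℂ (xGens D 1) ⊔ toSubmodule (UqCartan D)) := by
  refine mul_adjoin_le_adjoin_mul ?_
  change _ ≤ toSubmodule (xAlg D (-1)) * _
  have h1 : 1 ≤ toSubmodule (xAlg D (-1)) := one_le_toSubmodule _
  have hX := span_xGens_le D (-1)
  rw [Submodule.sup_mul, Submodule.mul_sup]
  refine sup_le ((span_xGens_one_mul_span_xGens_neg_one_le D).trans ?_) ?_
  · exact sup_le_sup (mul_le_mul_left hX _) (le_mul_of_one_le_left' h1)
  · exact (UqCartan_mul_span_xGens_le D (-1)).trans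
      (le_sup_of_le_right (mul_le_mul_left hX _))

lemma adjoin_generators :
    Algebra.adjoin ℂ (xGens D (-1) ∪ (xGens D 1 ∪ UqCartan D)) = ⊤ := by
  rw [eq_top_iff, ← (AlgHom.range_eq_top (Uq.proj D)).2 (RingQuot.mkAlgHom_surjective ℂ (Rel D)),
    ← Algebra.map_top, ← FreeAlgebra.adjoin_range_ι, AlgHom.map_adjoin]
  refine Algebra.adjoin_le ?_
  rintro _ ⟨_, ⟨g, rfl⟩, rfl⟩
  refine Algebra.subset_adjoin ?_
  rcases g with h | ⟨ε, i, r⟩ | ⟨i, m⟩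
  · exact .inr (.inr (k_mem_UqCartan D h))
  · rcases Int.units_eq_one_or ε with rfl | rfl
    exacts [.inr (.inl ⟨(i, r), rfl⟩), .inl ⟨(i, r), rfl⟩]
  · exact .inr (.inr (Algebra.subset_adjoin (.inr ⟨(i, m), rfl⟩)))

theorem triangular_decomposition : toSubmodule (xAlg D (-1)) * toSubmodule (UqCartan D) *
    toSubmodule (xAlg D 1) = ⊤ := by
  set N := toSubmodule (xAlg D (-1))
  set H := toSubmodule (UqCartan D)
  set P := toSubmodule (xAlg D 1)
  have hN : N * N = N := Subalgebra.isIdempotentElem_toSubmodule _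
  have hH : H * H = H := Subalgebra.isIdempotentElem_toSubmodule _
  have hP : P * P = P := Subalgebra.isIdempotentElem_toSubmodule _
  have hXP : (span ℂ (xGens D 1) ⊔ H) * (H * P) ≤ H * P := by
    rw [Submodule.sup_mul, ← mul_assoc, ← mul_assoc, hH]
    refine sup_le ?_ le_rfl
    calc span ℂ (xGens D 1) * H * P ≤ H * span ℂ (xGens D 1) * P :=
          mul_le_mul_left (span_xGens_mul_UqCartan_le D 1) _
      _ ≤ H * P * P := mul_le_mul_left (mul_le_mul_right (span_xGens_le D 1) _) _
      _ = H * P := by rw [mul_assoc, hP]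
  have hminus : span ℂ (xGens D (-1)) * (N * (H * P)) ≤ N * (H * P) := by
    rw [← mul_assoc]
    exact mul_le_mul_left ((mul_le_mul_left (span_xGens_le D (-1)) _).trans hN.le) _
  have hplus : (span ℂ (xGens D 1) ⊔ H) * (N * (H * P)) ≤ N * (H * P) := by
    rw [← mul_assoc]
    calc (span ℂ (xGens D 1) ⊔ H) * N * (H * P) ≤ N * (span ℂ (xGens D 1) ⊔ H) * (H * P) :=
          mul_le_mul_left (span_xGens_sup_UqCartan_mul_xAlg_le D) _
      _ = N * ((span ℂ (xGens D 1) ⊔ H) * (H * P)) := mul_assoc ..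
      _ ≤ N * (H * P) := mul_le_mul_right hXP _
  have hone : 1 ≤ N * (H * P) := one_le_mul (one_le_toSubmodule _)
    (one_le_mul (one_le_toSubmodule _) (one_le_toSubmodule _))
  have htop := adjoin_mul_le (R := ℂ) (s := xGens D (-1) ∪ (xGens D 1 ∪ UqCartan D))
    (Y := N * (H * P)) (by
      rw [Submodule.span_union, Submodule.span_union, Submodule.sup_mul]
      rw [show span ℂ (UqCartan D : Set (Uq D)) = H from Submodule.span_eq H]
      exact sup_le hminus hplus)
  rw [adjoin_generators, Algebra.top_toSubmodule] at htop
  rw [mul_assoc, eq_top_iff]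
  exact (le_mul_of_one_le_right' hone).trans htop

/-! ## Exponential polynomial sequences -/

section ExpPoly

open Polynomial

variable {R ι M : Type*} [CommRing R] [AddMonoidWithOne ι] [AddCommGroup M] [Module R M]

variable (R ι M) in
/-- The operator `b ↦ (n ↦ b (n + 1))` on sequences. It is used with `ι = ℕ` and `ι = ℤ`. -/
def shift : Module.End R (ι → M) := LinearMap.funLeft R M (· + 1)

lemma shift_apply (b : ι → M) (n : ι) : shift R ι M b n = b (n + 1) := rfl

lemma shift_pow_apply (k : ℕ) (b : ι → M) (n : ι) : (shift R ι M ^ k) b n = b (n + k) := by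
  induction k generalizing b with
  | zero => rw [pow_zero, Module.End.one_apply, Nat.cast_zero, add_zero]
  | succ k ih => rw [pow_succ, Module.End.mul_apply, ih, shift_apply, add_assoc, Nat.cast_succ]

lemma aeval_shift_apply (P : R[X]) (b : ι → M) (n : ι) :
    aeval (shift R ι M) P b n = P.sum fun k c => c • b (n + k) := by
  rw [aeval_eq_sum_range, P.sum_over_range (fun k => zero_smul R (b (n + k))),
    LinearMap.sum_apply, Finset.sum_apply]
  simp only [LinearMap.smul_apply, Pi.smul_apply, shift_pow_apply]

lemma aeval_shift_mem (P : R[X]) (E : Submodule R M) {b : ℤ → M} {r : ℤ}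
    (hb : ∀ n, r ≤ n → b n ∈ E) (n : ℤ) (hn : r ≤ n) : aeval (shift R ℤ M) P b n ∈ E := by
  rw [aeval_shift_apply]
  exact sum_mem fun k _ => E.smul_mem _ (hb _ (by lia))

/-- If `P` has invertible constant coefficient, then the recurrence that it defines can be solved
backwards. -/
lemma mem_of_aeval_shift_mem (P : R[X]) (hP : IsUnit (P.coeff 0)) (E : Submodule R M)
    {b : ℤ → M} {r N : ℤ} (hb : ∀ n, N ≤ n → b n ∈ E)
    (hPb : ∀ n, r ≤ n → aeval (shift R ℤ M) P b n ∈ E) (n : ℤ) (hn : r ≤ n) : b n ∈ E := by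
  have hback (j : ℕ) : ∀ n, r ≤ n → N - j ≤ n → b n ∈ E := by
    induction j with
    | zero => exact fun n _ hn => hb n (by simpa using hn)
    | succ j ih =>
      intro n hrn hn
      have htail : aeval (shift R ℤ M) P.divX b (n + 1) ∈ E :=
        aeval_shift_mem P.divX E (fun n' hn' => ih n' (by lia) (by lia)) (n + 1) le_rfl
      have h := hPb n hrn
      rw [← divX_mul_X_add P, mul_comm, map_add, map_mul, aeval_X, aeval_C, LinearMap.add_apply,
        Pi.add_apply, Module.End.mul_apply, shift_apply, Module.algebraMap_end_apply,
        Pi.smul_apply, E.add_mem_iff_right htail] at h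
      exact (Submodule.smul_mem_iff_of_isUnit E hP).1 h
  exact hback (N - n).toNat n hn (by lia)

variable (R M) in
/-- The sequences which are finite sums of sequences `m ↦ z ^ m m ^ k F`, with `z` invertible. -/
def expPoly : Submodule R (ℕ → M) :=
  Submodule.span R {s | ∃ (z : Rˣ) (k : ℕ) (F : M),
    s = fun m : ℕ => ((z : R) ^ m * (m : R) ^ k) • F}

lemma exists_fg_of_mem_expPoly {s : ℕ → M} (hs : s ∈ expPoly R M) :
    ∃ E : Submodule R M, E.FG ∧ ∀ m, s m ∈ E := by
  induction hs using Submodule.span_induction with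
  | mem s hs =>
    obtain ⟨z, k, F, rfl⟩ := hs
    exact ⟨R ∙ F, Submodule.fg_span_singleton F, fun m =>
      Submodule.smul_mem _ _ (Submodule.mem_span_singleton_self F)⟩
  | zero => exact ⟨⊥, Submodule.fg_bot, fun m => zero_mem _⟩
  | add s s' _ _ h h' =>
    obtain ⟨E, hE, h⟩ := h
    obtain ⟨E', hE', h'⟩ := h'
    exact ⟨E ⊔ E', hE.sup hE', fun m =>
      add_mem (Submodule.mem_sup_left (h m)) (Submodule.mem_sup_right (h' m))⟩
  | smul c s _ h =>
    obtain ⟨E, hE, h⟩ := h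
    exact ⟨E, hE, fun m => E.smul_mem c (h m)⟩

lemma aeval_shift_X_sub_C_pow (z : R) (F : M) (G : R → R) (l m : ℕ) :
    aeval (shift R ℕ M) ((X - C z) ^ l) (fun m => (z ^ m * G m) • F) m =
      (z ^ (m + l) * (fwdDiff 1)^[l] G m) • F := by
  induction l generalizing m with
  | zero => simp
  | succ l ih =>
    rw [pow_succ', map_mul, Module.End.mul_apply, map_sub, aeval_X, aeval_C, LinearMap.sub_apply,
      Pi.sub_apply, shift_apply, Module.algebraMap_end_apply, Pi.smul_apply, ih, ih, smul_smul,
      ← sub_smul, Function.iterate_succ_apply', fwdDiff]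
    congr 1
    push_cast
    ring

lemma exists_annihilator_of_mem_expPoly {s : ℕ → M} (hs : s ∈ expPoly R M) :
    ∃ P : R[X], IsUnit (P.coeff 0) ∧ aeval (shift R ℕ M) P s = 0 := by
  induction hs using Submodule.span_induction with
  | mem s hs =>
    obtain ⟨z, k, F, rfl⟩ := hs
    refine ⟨(X - C (z : R)) ^ (k + 1), ?_, funext fun m => ?_⟩
    · rw [coeff_zero_eq_eval_zero, eval_pow, eval_sub, eval_X, eval_C, zero_sub]
      exact z.isUnit.neg.pow _
    · rw [aeval_shift_X_sub_C_pow _ _ (· ^ k), fwdDiff_iter_pow_eq_zero_of_lt k.lt_succ_self,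
        Pi.zero_apply, mul_zero, zero_smul, Pi.zero_apply]
  | zero => exact ⟨1, by simp, map_zero _⟩
  | add s s' _ _ h h' =>
    obtain ⟨P, hP, h⟩ := h
    obtain ⟨P', hP', h'⟩ := h'
    refine ⟨P * P', by simpa using hP.mul hP', ?_⟩
    rw [map_add, map_mul, Module.End.mul_apply, Module.End.mul_apply, h', map_zero, add_zero,
      ← Module.End.mul_apply, ← map_mul, mul_comm, map_mul, Module.End.mul_apply, h, map_zero]
  | smul c s _ h =>
    obtain ⟨P, hP, h⟩ := h
    exact ⟨P, hP, by rw [map_smul, h, smul_zero]⟩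

lemma exists_annihilator_from {a : ℤ → M} {r : ℤ} (h : (fun m : ℕ => a (r + m)) ∈ expPoly R M) :
    ∃ P : R[X], IsUnit (P.coeff 0) ∧ ∀ n, r ≤ n → aeval (shift R ℤ M) P a n = 0 := by
  obtain ⟨P, hP, hPa⟩ := exists_annihilator_of_mem_expPoly h
  refine ⟨P, hP, fun n hn => ?_⟩
  obtain ⟨m, rfl⟩ := Int.le.dest hn
  have h := congrFun hPa m
  rw [aeval_shift_apply, Pi.zero_apply] at h
  rw [← h, aeval_shift_apply]
  simp only [Nat.cast_add, Nat.cast_id, add_assoc]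

/-- The recurrence satisfied by `a` from `0` on holds everywhere: the recurrences satisfied from
negative indices on propagate it backwards. -/
lemma exists_fg_of_forall_mem_expPoly {a : ℤ → M}
    (h : ∀ r : ℤ, (fun m : ℕ => a (r + m)) ∈ expPoly R M) :
    ∃ E : Submodule R M, E.FG ∧ ∀ n, a n ∈ E := by
  obtain ⟨E, hfg, hE⟩ := exists_fg_of_mem_expPoly (h 0)
  obtain ⟨P, hP, hPa⟩ := exists_annihilator_from (h 0)
  have hzero (n : ℤ) : aeval (shift R ℤ M) P a n = 0 := by
    obtain ⟨Q, hQ, hQa⟩ := exists_annihilator_from (h n)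
    rw [← Submodule.mem_bot R]
    refine mem_of_aeval_shift_mem Q hQ ⊥ hPa (fun m hm => ?_) n le_rfl
    rw [← Module.End.mul_apply, ← map_mul, mul_comm, map_mul, Module.End.mul_apply]
    exact aeval_shift_mem P ⊥ hQa m hm
  refine ⟨E, hfg, fun n => mem_of_aeval_shift_mem P hP E (N := 0) (fun n hn => ?_)
    (fun n _ => hzero n ▸ zero_mem E) n le_rfl⟩
  obtain ⟨m, rfl⟩ := Int.le.dest hn
  exact hE m

end ExpPoly

/-! ## Weight vectors in the objects of `Mod(U'_q(ĝ))` -/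

section WeightParts

variable {M : Type*} [AddCommGroup M] [Module (UqCu D) M] [Module ℂ M]
  [IsScalarTower ℂ (UqCu D) M]

/-- The weight space `W_ω` of a `ℂ`-subspace `W`. -/
noncomputable abbrev wtPart (W : Submodule ℂ M) (ω : Module.Dual ℚ 𝔥) : Submodule ℂ M :=
  W ⊓ weightSpace D (kActC D M) ω

namespace IsGenerating

variable {D} [Module Cu M] [IsScalarTower ℂ Cu M] {W : Submodule ℂ M} (hW : IsGenerating D W)

include hW

lemma span_eq_iSup (R : Type*) [Semiring R] [Module R M] [SMul ℂ R] [IsScalarTower ℂ R M] :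
    Submodule.span R (W : Set M) = ⨆ ω, Submodule.span R (wtPart D W ω : Set M) := by
  conv_lhs => rw [← hW.cartan.iSup_eq, Submodule.iSup_eq_span, Submodule.span_span_of_tower,
    Submodule.span_iUnion]

lemma span_eq_top : Submodule.span Cu (W : Set M) = ⊤ := by
  rw [← LinearMap.range_eq_top.2 hW.bijective.2, LinearMap.range_liftBaseChange,
    Submodule.range_subtype]

lemma fg_span_wtPart (R : Type*) [Semiring R] [Module R M] [SMul ℂ R] [IsScalarTower ℂ R M]
    (ω : Module.Dual ℚ 𝔥) : (Submodule.span R (wtPart D W ω : Set M)).FG := by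
  obtain ⟨s, hs⟩ := (Submodule.fg_iff_finiteDimensional (wtPart D W ω)).2 (hW.cartan.finite ω)
  exact ⟨s, by rw [← hs, Submodule.span_span_of_tower]⟩

lemma exists_extend {ω : Module.Dual ℚ 𝔥} (f : wtPart D W ω →ₗ[ℂ] M) :
    ∃ F : Module.End Cu M, ∀ w : wtPart D W ω, F w = f w := by
  obtain ⟨g, hg⟩ := LinearMap.exists_extend f
  let e := LinearEquiv.ofBijective _ hW.bijective
  refine ⟨(LinearMap.liftBaseChange Cu (g ∘ₗ W.subtype)) ∘ₗ e.symm.toLinearMap, fun w => ?_⟩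
  have hw : e.symm (w : M) = (1 : Cu) ⊗ₜ[ℂ] (⟨w, w.2.1⟩ : W) := by
    rw [LinearEquiv.symm_apply_eq, LinearEquiv.ofBijective_apply,
      LinearMap.liftBaseChange_one_tmul]
    rfl
  rw [LinearMap.comp_apply, LinearEquiv.coe_coe, hw, LinearMap.liftBaseChange_one_tmul, ← hg]
  rfl

end IsGenerating

end WeightParts

section WeightVectors

variable {M : Type*} [AddCommGroup M] [Module (UqCu D) M] [Module Cu M]
  [IsScalarTower Cu (UqCu D) M]

lemma incl_smul_comm (c : Cu) (a : Uq D) (v : M) : incl D a • c • v = c • incl D a • v :=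
  map_smul (act D M a) c v

lemma iSupIndep_weightSpaceCu : iSupIndep (weightSpaceCu D M) := iSupIndep_weightSpace D _

lemma iSupIndep_restrictScalars_weightSpaceCu (R : Type*) [Ring R] [Module R M] [SMul R Cu]
    [IsScalarTower R Cu M] : iSupIndep fun ω => (weightSpaceCu D M ω).restrictScalars R := by
  classical
  rw [iSupIndep_iff_finsetSum_eq_zero_imp_eq_zero]
  exact (iSupIndep_iff_finsetSum_eq_zero_imp_eq_zero (weightSpaceCu D M)).1
    (iSupIndep_weightSpaceCu D)

variable [Module ℂ M] [IsScalarTower ℂ Cu M]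

lemma mem_weightSpaceCu {ω : Module.Dual ℚ 𝔥} {v : M} :
    v ∈ weightSpaceCu D M ω ↔ ∀ h, incl D (Uq.k D h) • v = D.qpow (ω h) • v := by
  change (∀ h, incl D (Uq.k D h) • v = algebraMap ℂ Cu (D.qpow (ω h)) • v) ↔ _
  simp only [algebraMap_smul]

lemma incl_smul_complex_comm (c : ℂ) (a : Uq D) (v : M) : incl D a • c • v = c • incl D a • v := by
  rw [← algebraMap_smul Cu, incl_smul_comm, algebraMap_smul]

lemma UqCartan_le_centralizer : UqCartan D ≤ Subalgebra.centralizer ℂ (Set.range (Uq.k D)) := by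
  rw [← adjoin_cartanGens]
  refine Algebra.adjoin_le ?_
  rintro _ (⟨h, rfl⟩ | ⟨⟨ε, i, m⟩, rfl⟩) _ ⟨h', rfl⟩
  · rw [Uq.k_mul_k, Uq.k_mul_k, add_comm]
  · exact Uq.k_mul_phiN D h' ε i m

lemma UqCartan_smul_mem {ω : Module.Dual ℚ 𝔥} {v : M} (hv : v ∈ weightSpaceCu D M ω) {a : Uq D}
    (ha : a ∈ UqCartan D) : incl D a • v ∈ weightSpaceCu D M ω := by
  rw [mem_weightSpaceCu] at hv ⊢
  intro h
  rw [← mul_smul, ← map_mul, UqCartan_le_centralizer D ha _ ⟨h, rfl⟩, map_mul, mul_smul, hv h,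
    incl_smul_complex_comm]

variable [IsScalarTower ℂ (UqCu D) M]

lemma x_smul_mem {ω : Module.Dual ℚ 𝔥} {v : M} (hv : v ∈ weightSpaceCu D M ω) (ε : ℤˣ) (i : I)
    (r : ℤ) : incl D (Uq.x D ε i r) • v ∈ weightSpaceCu D M (ω + (ε : ℤ) • D.root i) := by
  rw [mem_weightSpaceCu] at hv ⊢
  intro h
  rw [← mul_smul, ← map_mul, Uq.k_mul_x, map_smul, smul_assoc, map_mul, mul_smul, hv h,
    incl_smul_complex_comm, smul_smul, LinearMap.add_apply, LinearMap.smul_apply, zsmul_eq_mul,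
    add_comm, Datum.qpow_add]

lemma mem_weightSpace_kActC {ω : Module.Dual ℚ 𝔥} {v : M} :
    v ∈ weightSpace D (kActC D M) ω ↔ v ∈ weightSpaceCu D M ω := by
  rw [mem_weightSpaceCu]
  rfl

lemma wtPart_subset (W : Submodule ℂ M) (ω : Module.Dual ℚ 𝔥) :
    (wtPart D W ω : Set M) ⊆ weightSpaceCu D M ω :=
  fun _ hv => (mem_weightSpace_kActC D).1 hv.2

namespace IsGenerating

variable {D} {W : Submodule ℂ M} (hW : IsGenerating D W)

include hW

lemma weightSpaceCu_inf_span (R : Type*) [CommRing R] [Algebra R Cu] [Module R M]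
    [IsScalarTower R Cu M] [SMul ℂ R] [IsScalarTower ℂ R M] (ω : Module.Dual ℚ 𝔥) :
    (weightSpaceCu D M ω).restrictScalars R ⊓ Submodule.span R (W : Set M) =
      Submodule.span R (wtPart D W ω : Set M) := by
  rw [hW.span_eq_iSup R]
  exact inf_iSup_eq_of_iSupIndep (iSupIndep_restrictScalars_weightSpaceCu D R)
    (fun ω => Submodule.span_le.2 (wtPart_subset D W ω)) ω

lemma weightSpaceCu_eq_span (ω : Module.Dual ℚ 𝔥) :
    weightSpaceCu D M ω = Submodule.span Cu (wtPart D W ω : Set M) := by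
  rw [← hW.weightSpaceCu_inf_span Cu, hW.span_eq_top, inf_top_eq, Submodule.restrictScalars_self]

lemma iSup_weightSpaceCu : ⨆ ω, weightSpaceCu D M ω = ⊤ := by
  simp only [hW.weightSpaceCu_eq_span, ← hW.span_eq_iSup, hW.span_eq_top]

lemma weightSpaceCu_eq_bot_iff (ω : Module.Dual ℚ 𝔥) :
    weightSpaceCu D M ω = ⊥ ↔ wtPart D W ω = ⊥ := by
  rw [hW.weightSpaceCu_eq_span, Submodule.span_eq_bot, Submodule.eq_bot_iff]
  rfl

lemma exists_regular (ω : Module.Dual ℚ 𝔥) (ε : ℤˣ) (i : I) (r : ℤ) :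
    ∃ (S : Finset (ℕ × ℕ × ℂˣ)) (F : ℕ × ℕ × ℂˣ → Module.End Cu M),
      ∀ (m : ℕ), ∀ y ∈ weightSpaceCu D M ω, incl D (Uq.x D ε i (r + (ε : ℤ) * m)) • y =
        ∑ t ∈ S, (algebraMap ℂ Cu ((t.2.2 : ℂ) ^ m) * (RatFunc.X : Cu) ^ (t.1 * m) *
            (m : Cu) ^ t.2.1) • F t y := by
  obtain ⟨S, f, hf⟩ := hW.regular ω ε i r
  choose F hF using fun t => hW.exists_extend (f t)
  refine ⟨S, F, fun m y hy => ?_⟩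
  rw [hW.weightSpaceCu_eq_span] at hy
  induction hy using Submodule.span_induction with
  | mem w hw => exact (hf m ⟨w, hw⟩).trans (Finset.sum_congr rfl fun t _ => by rw [← hF t ⟨w, hw⟩])
  | zero => simp only [smul_zero, map_zero, Finset.sum_const_zero]
  | add y z _ _ hy hz => simp only [smul_add, hy, hz, map_add, Finset.sum_add_distrib]
  | smul c y _ hy => simp only [incl_smul_comm, hy, map_smul, Finset.smul_sum, smul_comm c]

lemma x_smul_mem_expPoly {ω : Module.Dual ℚ 𝔥} {y : M} (hy : y ∈ weightSpaceCu D M ω) (ε : ℤˣ)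
    (i : I) (r : ℤ) :
    (fun m : ℕ => incl D (Uq.x D ε i (r + (ε : ℤ) * m)) • y) ∈ expPoly 𝒜 M := by
  obtain ⟨S, F, hF⟩ := hW.exists_regular ω ε i r
  obtain ⟨u, hu⟩ := exists_unit_coe_eq_X
  have hsum : (fun m : ℕ => incl D (Uq.x D ε i (r + (ε : ℤ) * m)) • y) = ∑ t ∈ S, fun m : ℕ =>
      (algebraMap ℂ Cu ((t.2.2 : ℂ) ^ m) * RatFunc.X ^ (t.1 * m) * (m : Cu) ^ t.2.1) • F t y :=
    funext fun m => by rw [hF m y hy, Finset.sum_apply]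
  rw [hsum]
  refine sum_mem fun t _ => Submodule.subset_span
    ⟨Units.map (algebraMap ℂ 𝒜 : ℂ →* 𝒜) t.2.2 * u ^ t.1, t.2.1, F t y, funext fun m => ?_⟩
  change _ = ((_ : 𝒜) : Cu) • F t y
  push_cast
  rw [hu, mul_pow, ← pow_mul]
  rfl

lemma exists_fg_x_smul {ω : Module.Dual ℚ 𝔥} {y : M} (hy : y ∈ weightSpaceCu D M ω) (ε : ℤˣ)
    (i : I) : ∃ E : Submodule 𝒜 M, E.FG ∧ ∀ r, incl D (Uq.x D ε i r) • y ∈ E := by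
  obtain ⟨E, hfg, hE⟩ := exists_fg_of_forall_mem_expPoly (R := 𝒜)
    (a := fun n : ℤ => incl D (Uq.x D ε i ((ε : ℤ) * n)) • y)
    fun r => by simpa only [mul_add] using hW.x_smul_mem_expPoly hy ε i ((ε : ℤ) * r)
  refine ⟨E, hfg, fun r => ?_⟩
  simpa only [← mul_assoc, Int.units_coe_mul_self, one_mul] using hE ((ε : ℤ) * r)

lemma UqCartan_smul_mem_span {ω : Module.Dual ℚ 𝔥} {w : M} (hw : w ∈ wtPart D W ω) {a : Uq D}
    (ha : a ∈ UqCartan D) : incl D a • w ∈ Submodule.span 𝒜 (wtPart D W ω : Set M) := by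
  have h : incl D a • w ∈ Submodule.span laurentRing (wtPart D W ω : Set M) := by
    rw [← hW.weightSpaceCu_inf_span laurentRing]
    exact ⟨UqCartan_smul_mem D (wtPart_subset D W ω hw) ha,
      hW.lattice_stable a ha w (Submodule.subset_span hw.1)⟩
  generalize incl D a • w = z at h
  induction h using Submodule.span_induction with
  | mem z hz => exact Submodule.subset_span hz
  | zero => exact zero_mem _
  | add y z _ _ hy hz => exact add_mem hy hz
  | smul c y _ hy => exact Submodule.smul_mem _ (⟨c, laurentRing_le_𝒜 c.2⟩ : 𝒜) hy

lemma exists_fg_UqCartan_smul {ω : Module.Dual ℚ 𝔥} {y : M} (hy : y ∈ weightSpaceCu D M ω) :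
    ∃ E : Submodule 𝒜 M, E.FG ∧ ∀ a ∈ UqCartan D, incl D a • y ∈ E := by
  rw [hW.weightSpaceCu_eq_span] at hy
  induction hy using Submodule.span_induction with
  | mem w hw => exact ⟨_, hW.fg_span_wtPart 𝒜 ω, fun a ha => hW.UqCartan_smul_mem_span hw ha⟩
  | zero => exact ⟨⊥, Submodule.fg_bot, fun a _ => by rw [smul_zero]; exact zero_mem _⟩
  | add y z _ _ hy hz =>
    obtain ⟨E, hE, hEy⟩ := hy
    obtain ⟨E', hE', hEz⟩ := hz
    refine ⟨E ⊔ E', hE.sup hE', fun a ha => ?_⟩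
    rw [smul_add]
    exact add_mem (Submodule.mem_sup_left (hEy a ha)) (Submodule.mem_sup_right (hEz a ha))
  | smul c y _ hy =>
    obtain ⟨E, hE, hEy⟩ := hy
    exact ⟨E.map ((LinearMap.lsmul Cu M c).restrictScalars 𝒜), hE.map _, fun a ha =>
      ⟨_, hEy a ha, (incl_smul_comm D c a y).symm⟩⟩

end IsGenerating

end WeightVectors

/-! ## Submodules of the objects of `Mod(U'_q(ĝ))` -/

section LinearAlgebra

lemma exists_linearIndependent_span_eq {R : Type*} (K : Type*) {X : Type*} [CommRing R] [IsDomain R]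
    [IsPrincipalIdealRing R] [Field K] [Algebra R K] [IsFractionRing R K] [AddCommGroup X]
    [Module R X] [Module K X] [IsScalarTower R K X] {L : Submodule R X} (hL : L.FG) :
    ∃ (d : ℕ) (b : Fin d → X),
      LinearIndependent K b ∧ Submodule.span R (Set.range b) = L := by
  have : Module.Finite R L := Module.Finite.iff_fg.2 hL
  have : Module.IsTorsionFree R X := .trans_faithfulSMul R K X
  let e := Module.finBasis R L
  refine ⟨_, L.subtype ∘ e, (LinearIndependent.iff_fractionRing R K).1
    (e.linearIndependent.map' L.subtype (Submodule.ker_subtype L)), ?_⟩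
  rw [Set.range_comp, ← Submodule.map_span, e.span_eq, Submodule.map_subtype_top]

lemma bijective_liftBaseChange_span_range {k K X ι : Type*} [Field k] [Field K] [Algebra k K]
    [AddCommGroup X] [Module k X] [Module K X] [IsScalarTower k K X] (B : Module.Basis ι K X) :
    Function.Bijective
      (LinearMap.liftBaseChange K (Submodule.span k (Set.range B)).subtype) := by
  have hli : LinearIndependent k B := B.linearIndependent.restrict_scalars' k
  have heq : LinearMap.liftBaseChange K (Submodule.span k (Set.range B)).subtype =
      (((Module.Basis.span hli).baseChange K).equiv B (Equiv.refl ι)).toLinearMap := by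
    refine ((Module.Basis.span hli).baseChange K).ext fun j => ?_
    rw [LinearEquiv.coe_coe, Module.Basis.equiv_apply, Module.Basis.baseChange_apply,
      LinearMap.liftBaseChange_one_tmul]
    exact congrArg Subtype.val (Module.Basis.span_apply hli j)
  rw [heq]
  exact LinearEquiv.bijective _

lemma iSup_comap_subtype_eq_top {K M ι : Type*} [Semiring K] [AddCommMonoid M] [Module K M]
    {N : Submodule K M} {A : ι → Submodule K M} (h : N ⊓ ⨆ i, A i = ⨆ i, N ⊓ A i)
    (htop : ⨆ i, A i = ⊤) : ⨆ i, (A i).comap N.subtype = ⊤ := by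
  refine Submodule.map_injective_of_injective N.injective_subtype ?_
  simp only [Submodule.map_iSup, Submodule.map_comap_subtype]
  rw [← h, htop, inf_top_eq, Submodule.map_subtype_top]

end LinearAlgebra

variable {D} in
lemma InModCartan.of_weightSpace_eq_bot {M₀ M : Type*} [AddCommGroup M₀] [Module ℂ M₀]
    [AddCommGroup M] [Module ℂ M] {κ₀ : 𝔥 → Module.End ℂ M₀} {κ : 𝔥 → Module.End ℂ M}
    {W₀ : Submodule ℂ M₀} {W : Submodule ℂ M} (h₀ : InModCartan D κ₀ W₀)
    (hsup : ⨆ ω, W ⊓ weightSpace D κ ω = W)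
    (hfin : ∀ ω, FiniteDimensional ℂ ↥(W ⊓ weightSpace D κ ω))
    (hbot : ∀ ω, W₀ ⊓ weightSpace D κ₀ ω = ⊥ → W ⊓ weightSpace D κ ω = ⊥) :
    InModCartan D κ W where
  stable h := by
    have hle : ⨆ ω, W ⊓ weightSpace D κ ω ≤ W.comap (κ h) := iSup_le fun ω w hw => by
      rw [Submodule.mem_comap, hw.2 h]
      exact Submodule.smul_mem _ _ hw.1
    rwa [hsup] at hle
  independent := (iSupIndep_weightSpace D κ).mono fun ω => inf_le_right
  iSup_eq := hsup
  finite := hfin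
  integrable ω i := by
    obtain ⟨R, hR⟩ := h₀.integrable ω i
    exact ⟨R, fun r hr => ⟨hbot _ (hR r hr).1, hbot _ (hR r hr).2⟩⟩
  bounded := by
    obtain ⟨S, hS⟩ := h₀.bounded
    exact ⟨S, fun ω hω => hS ω fun h => hω (hbot ω h)⟩

section Submodules

variable {M : Type*} [AddCommGroup M] [Module (UqCu D) M] [Module Cu M]
  [IsScalarTower Cu (UqCu D) M]

/-- The elements `k_h` and `φ^ε_{i, ε m}` of `U_q(ĥ)`, whose generalized eigenvectors are the
`(l,u)`-weight vectors. -/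
noncomputable def luGen : 𝔥 ⊕ (ℤˣ × I × ℕ) → Uq D :=
  Sum.elim (Uq.k D) fun t => Uq.phi D t.1 t.2.1 ((t.1 : ℤ) * t.2.2)

/-- The eigenvalues of the operators `luGen` on the `(l,u)`-weight vectors of a given
`(l,u)`-weight. -/
noncomputable def luVal (Λ : LUWeight D) : 𝔥 ⊕ (ℤˣ × I × ℕ) → Cu :=
  Sum.elim (fun h => algebraMap ℂ Cu (D.qpow (Λ.wt h))) fun t => Λ.Ψ t.1 t.2.1 t.2.2

lemma luVal_injective : Function.Injective (luVal D) := by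
  rintro ⟨wt, Ψ, _⟩ ⟨wt', Ψ', _⟩ h
  obtain rfl : wt = wt' :=
    weight_eigenvalues_injective D (F := Cu) (funext fun x => congrFun h (Sum.inl x))
  obtain rfl : Ψ = Ψ' :=
    funext fun ε => funext fun i => funext fun m => Subtype.ext (congrFun h (Sum.inr (ε, i, m)))
  rfl

lemma luWeightSpace_le_jointGenEigenspace (Λ : LUWeight D) :
    luWeightSpace D M Λ ≤ jointGenEigenspace (fun k => act D M (luGen D k)) (luVal D Λ) := by
  rintro v ⟨hwt, p, hp⟩
  rw [mem_jointGenEigenspace]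
  rintro (h | ⟨ε, i, m⟩)
  · exact mem_jointGenEigenspace.1 (weightSpace_le_jointGenEigenspace D _ _ hwt) h
  · exact ⟨p, hp ε i m⟩

lemma iSupIndep_luWeightSpace : iSupIndep (luWeightSpace D M) :=
  ((iSupIndep_jointGenEigenspace _).comp (luVal_injective D)).mono
    (luWeightSpace_le_jointGenEigenspace D)

variable (N : Submodule (UqCu D) M)

lemma coe_act_sub_pow (a : Uq D) (c : Cu) (p : ℕ) (n : N) :
    ((((act D N a - algebraMap Cu (Module.End Cu N) c) ^ p) n : N) : M) =
      ((act D M a - algebraMap Cu (Module.End Cu M) c) ^ p) (n : M) := by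
  induction p generalizing n with
  | zero => rfl
  | succ p ih =>
    rw [pow_succ, pow_succ, Module.End.mul_apply, Module.End.mul_apply, ih]
    rfl

lemma coe_mem_weightSpaceCu {ω : Module.Dual ℚ 𝔥} {n : N} :
    (n : M) ∈ weightSpaceCu D M ω ↔ n ∈ weightSpaceCu D N ω :=
  forall_congr' fun h => (Subtype.ext_iff (a1 := act D N (Uq.k D h) n)
    (a2 := algebraMap ℂ Cu (D.qpow (ω h)) • n)).symm

lemma coe_mem_luWeightSpace {Λ : LUWeight D} {n : N} :
    (n : M) ∈ luWeightSpace D M Λ ↔ n ∈ luWeightSpace D N Λ := by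
  refine and_congr (coe_mem_weightSpaceCu D N) (exists_congr fun p => forall_congr' fun ε =>
    forall_congr' fun i => forall_congr' fun m => ?_)
  rw [← coe_act_sub_pow, ZeroMemClass.coe_eq_zero]

lemma iSup_weightSpaceCu_submodule (h : ⨆ ω, weightSpaceCu D M ω = ⊤) :
    ⨆ ω, weightSpaceCu D N ω = ⊤ := by
  have hcomap (ω : Module.Dual ℚ 𝔥) : weightSpaceCu D N ω =
      (weightSpaceCu D M ω).comap (N.restrictScalars Cu).subtype :=
    Submodule.ext fun n => (coe_mem_weightSpaceCu D N).symm
  simp only [hcomap]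
  exact iSup_comap_subtype_eq_top
    (inf_iSup_weightSpace D fun h _ hn => N.smul_mem (incl D (Uq.k D h)) hn) h

lemma iSup_luWeightSpace_submodule (h : ⨆ Λ, luWeightSpace D M Λ = ⊤) :
    ⨆ Λ, luWeightSpace D N Λ = ⊤ := by
  have hcomap (Λ : LUWeight D) : luWeightSpace D N Λ =
      (luWeightSpace D M Λ).comap (N.restrictScalars Cu).subtype :=
    Submodule.ext fun n => (coe_mem_luWeightSpace D N).symm
  simp only [hcomap]
  exact iSup_comap_subtype_eq_top (inf_iSup_eq_of_le_jointGenEigenspace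
    (fun k _ hn => N.smul_mem (incl D (luGen D k)) hn) (luVal_injective D)
    (luWeightSpace_le_jointGenEigenspace D)) h

variable [Module ℂ M] [IsScalarTower ℂ Cu M] [IsScalarTower ℂ (UqCu D) M]

/-- The weight `ω` part of the intersection of `N` with the `ℂ[u, u⁻¹]`-lattice spanned by `W`. -/
noncomputable def latticeWt (W : Submodule ℂ M) (ω : Module.Dual ℚ 𝔥) : Submodule laurentRing N :=
  (Submodule.span laurentRing (W : Set M)).comap
      ((N.restrictScalars Cu).subtype.restrictScalars laurentRing) ⊓
    (weightSpaceCu D N ω).restrictScalars laurentRing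

lemma wtPart_span_range {κ : Module.Dual ℚ 𝔥 → Type*} {b : (Σ ω, κ ω) → M}
    (hb : ∀ t, b t ∈ weightSpaceCu D M t.1) (ω : Module.Dual ℚ 𝔥) :
    wtPart D (Submodule.span ℂ (Set.range b)) ω =
      Submodule.span ℂ (Set.range fun j => b ⟨ω, j⟩) := by
  rw [Set.range_sigma_eq_iUnion_range, Submodule.span_iUnion, wtPart, inf_comm]
  refine inf_iSup_eq_of_iSupIndep (iSupIndep_weightSpace D (kActC D M)) (fun ω => ?_) ω
  rw [Submodule.span_le]
  rintro _ ⟨j, rfl⟩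
  exact (mem_weightSpace_kActC D).2 (hb ⟨ω, j⟩)

namespace IsGenerating

variable {D} {W : Submodule ℂ M} (hW : IsGenerating D W)

include hW

lemma fg_latticeWt (ω : Module.Dual ℚ 𝔥) : (latticeWt D N W ω).FG := by
  have hnoeth := isNoetherian_of_fg_of_noetherian _ (hW.fg_span_wtPart laurentRing ω)
  refine Submodule.fg_of_fg_map_injective
    ((N.restrictScalars Cu).subtype.restrictScalars laurentRing) Subtype.val_injective
    (isNoetherian_submodule.1 hnoeth _ ?_)
  rintro _ ⟨n, hn, rfl⟩
  rw [← hW.weightSpaceCu_inf_span laurentRing]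
  exact ⟨(coe_mem_weightSpaceCu D N).2 hn.2, hn.1⟩

lemma span_latticeWt (ω : Module.Dual ℚ 𝔥) :
    Submodule.span Cu (latticeWt D N W ω : Set N) = weightSpaceCu D N ω := by
  refine le_antisymm (Submodule.span_le.2 fun n hn => hn.2) fun n hn => ?_
  have hnM := (coe_mem_weightSpaceCu D N).2 hn
  rw [hW.weightSpaceCu_eq_span] at hnM
  obtain ⟨p, hp⟩ :=
    multiple_mem_span_of_mem_localization_span (nonZeroDivisors laurentRing) Cu _ _ hnM
  have hp0 : ((p : laurentRing) : Cu) ≠ 0 := by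
    simp
  have hpn : ((p : laurentRing) : Cu) • n ∈ latticeWt D N W ω :=
    ⟨Submodule.span_mono inf_le_left hp, Submodule.smul_mem _ _ hn⟩
  rw [← inv_smul_smul₀ hp0 n]
  exact Submodule.smul_mem _ _ (Submodule.subset_span hpn)

lemma exists_basis_span_eq_latticeWt :
    ∃ (d : Module.Dual ℚ 𝔥 → ℕ) (B : Module.Basis (Σ ω, Fin (d ω)) Cu N),
      ∀ ω, Submodule.span laurentRing (Set.range fun j => B ⟨ω, j⟩) = latticeWt D N W ω := by
  choose d b hli hb using fun ω => exists_linearIndependent_span_eq Cu (hW.fg_latticeWt N ω)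
  have hspan (ω) : Submodule.span Cu (Set.range (b ω)) = weightSpaceCu D N ω := by
    rw [← hW.span_latticeWt, ← hb, Submodule.span_span_of_tower]
  have hindep : LinearIndependent Cu fun t : Σ ω, Fin (d ω) => b t.1 t.2 := by
    refine linearIndependent_iUnion_finite hli fun ω S _ hω => ?_
    simp only [hspan]
    exact (iSupIndep_weightSpaceCu D ω).mono_right
      (iSup₂_mono' fun ω' h => ⟨ω', ne_of_mem_of_not_mem h hω, le_rfl⟩)
  have htop : Submodule.span Cu (Set.range fun t : Σ ω, Fin (d ω) => b t.1 t.2) = ⊤ := by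
    rw [Set.range_sigma_eq_iUnion_range, Submodule.span_iUnion,
      ← iSup_weightSpaceCu_submodule D N hW.iSup_weightSpaceCu]
    exact iSup_congr hspan
  exact ⟨d, .mk hindep htop.ge, fun ω => by simp only [Module.Basis.mk_apply, ← hb ω]⟩

lemma UqCartan_smul_mem_iSup_latticeWt {a : Uq D} (ha : a ∈ UqCartan D) {n : N}
    (hn : n ∈ ⨆ ω, latticeWt D N W ω) : incl D a • n ∈ ⨆ ω, latticeWt D N W ω := by
  have hle : ⨆ ω, latticeWt D N W ω ≤
      (⨆ ω, latticeWt D N W ω).comap ((act D N a).restrictScalars laurentRing) :=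
    iSup_le fun ω n hn => Submodule.mem_iSup_of_mem ω
      ⟨hW.lattice_stable a ha n hn.1, UqCartan_smul_mem D hn.2 ha⟩
  exact hle hn

lemma exists_regular_submodule (W' : Submodule ℂ N) (ω : Module.Dual ℚ 𝔥) (ε : ℤˣ) (i : I)
    (r : ℤ) :
    ∃ (S : Finset (ℕ × ℕ × ℂˣ)) (f : ℕ × ℕ × ℂˣ → (wtPart D W' ω →ₗ[ℂ] N)),
      ∀ (m : ℕ) (w : wtPart D W' ω), incl D (Uq.x D ε i (r + (ε : ℤ) * m)) • (w : N) =
        ∑ t ∈ S, (algebraMap ℂ Cu ((t.2.2 : ℂ) ^ m) * (RatFunc.X : Cu) ^ (t.1 * m) *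
          (m : Cu) ^ t.2.1) • f t w := by
  obtain ⟨S, F, hF⟩ := hW.exists_regular ω ε i r
  obtain ⟨π, hπ⟩ := LinearMap.exists_leftInverse_of_injective (N.restrictScalars Cu).subtype
    (Submodule.ker_subtype _)
  have hπ_coe (n : N) : π (n : M) = n := DFunLike.congr_fun hπ n
  refine ⟨S, fun t => ((π ∘ₗ F t ∘ₗ (N.restrictScalars Cu).subtype).restrictScalars ℂ) ∘ₗ
    (wtPart D W' ω).subtype, fun m w => ?_⟩
  have hw : ((w : N) : M) ∈ weightSpaceCu D M ω :=
    (coe_mem_weightSpaceCu D N).2 (wtPart_subset D W' ω w.2)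
  have hproj := congrArg π (hF m _ hw)
  simp only [map_sum, map_smul] at hproj
  rw [← hπ_coe (incl D _ • (w : N))]
  exact hproj

lemma inModCartan_submodule {W' : Submodule ℂ N} (hsup : ⨆ ω, wtPart D W' ω = W')
    (hfin : ∀ ω, FiniteDimensional ℂ (wtPart D W' ω)) : InModCartan D (kActC D N) W' := by
  refine hW.cartan.of_weightSpace_eq_bot hsup hfin fun ω hω => ?_
  have hM : weightSpaceCu D M ω = ⊥ := (hW.weightSpaceCu_eq_bot_iff ω).2 hω
  refine (Submodule.eq_bot_iff _).2 fun n hn => Subtype.ext ?_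
  have hnM := (coe_mem_weightSpaceCu D N).2 (wtPart_subset D W' ω hn)
  rwa [hM, Submodule.mem_bot] at hnM

lemma exists_submodule : ∃ W' : Submodule ℂ N, IsGenerating D W' := by
  obtain ⟨d, B, hB⟩ := hW.exists_basis_span_eq_latticeWt N
  let W' : Submodule ℂ N := Submodule.span ℂ (Set.range B)
  have hmem (t) : B t ∈ weightSpaceCu D N t.1 :=
    ((hB t.1).le (Submodule.subset_span ⟨t.2, rfl⟩)).2
  have hpart := wtPart_span_range D hmem
  have hsup : ⨆ ω, wtPart D W' ω = W' := by
    simp only [W', hpart, ← Submodule.span_iUnion, ← Set.range_sigma_eq_iUnion_range]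
  have hfin (ω) : FiniteDimensional ℂ (wtPart D W' ω) := by
    rw [hpart]
    exact FiniteDimensional.span_of_finite ℂ (Set.finite_range _)
  have hlattice : Submodule.span laurentRing (W' : Set N) = ⨆ ω, latticeWt D N W ω := by
    rw [Submodule.span_span_of_tower, Set.range_sigma_eq_iUnion_range, Submodule.span_iUnion]
    exact iSup_congr hB
  exact ⟨W', bijective_liftBaseChange_span_range B, hW.inModCartan_submodule N hsup hfin,
    fun a ha n hn => hlattice ▸ hW.UqCartan_smul_mem_iSup_latticeWt N ha (hlattice ▸ hn),
    hW.exists_regular_submodule N W'⟩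

end IsGenerating

variable {D} in
lemma InModUqCu.submodule (hM : InModUqCu D M) : InModUqCu D N := by
  obtain ⟨W, hW⟩ := hM.exists_generating
  exact ⟨hW.exists_submodule N, iSupIndep_luWeightSpace D,
    iSup_luWeightSpace_submodule D N hM.lu_iSup⟩

end Submodules

/-! ## The `𝒜`-form generated by a vector -/

/-- The order ideal of the finitely generated submodules of a module over a Noetherian ring. -/
def fgIdeal (R M : Type*) [Ring R] [IsNoetherianRing R] [AddCommGroup M] [Module R M] :
    Order.Ideal (Submodule R M) where
  carrier := {E | E.FG}
  lower' _ _ hle hE := isNoetherian_submodule.1 (isNoetherian_of_fg_of_noetherian _ hE) _ hle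
  nonempty' := ⟨⊥, Submodule.fg_bot⟩
  directed' _ hE _ hE' := ⟨_, hE.sup hE', le_sup_left, le_sup_right⟩

lemma Datum.exists_height : ∃ ρ : Module.Dual ℚ 𝔥 →ₗ[ℚ] ℚ, ∀ i, ρ (D.root i) = 1 := by
  obtain ⟨ρ, hρ⟩ := LinearMap.exists_extend
    ((Finsupp.linearCombination ℚ fun _ : I => (1 : ℚ)) ∘ₗ D.root_indep.repr)
  refine ⟨ρ, fun i => ?_⟩
  have h := DFunLike.congr_fun hρ ⟨D.root i, Submodule.subset_span ⟨i, rfl⟩⟩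
  rwa [LinearMap.comp_apply, LinearMap.comp_apply, D.root_indep.repr_eq_single i _ rfl,
    Finsupp.linearCombination_single, smul_eq_mul, mul_one] at h

variable {D} in
lemma height_sum_roots {ρ : Module.Dual ℚ 𝔥 →ₗ[ℚ] ℚ} (hρ : ∀ i, ρ (D.root i) = 1) (l : List I) :
    ρ (l.map D.root).sum = l.length := by
  induction l with
  | nil => simp
  | cons i l ih => simp [ih, hρ, add_comm]

lemma finite_setOf_sum_roots_eq (ω : Module.Dual ℚ 𝔥) :
    {l : List I | (l.map D.root).sum = ω}.Finite := by
  obtain ⟨ρ, hρ⟩ := D.exists_height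
  refine (List.finite_length_le I ⌈ρ ω⌉₊).subset fun l hl => ?_
  rw [Set.mem_ofPred_eq, ← hl, height_sum_roots hρ, Nat.ceil_natCast]

section Orbits

variable {M : Type*} [AddCommGroup M] [Module (UqCu D) M] [Module Cu M]

/-- For every vector `y`, the set `A.y` is contained in a member of the ideal `𝒞` of
`𝒜`-submodules. -/
def HasOrbitsIn (𝒞 : Order.Ideal (Submodule 𝒜 M)) (A : Set (Uq D)) : Prop :=
  ∀ y : M, ∃ E ∈ 𝒞, ∀ a ∈ A, incl D a • y ∈ E

variable {D} in
lemma HasOrbitsIn.of_iSup_eq_top {ι : Type*} {V : ι → Submodule Cu M} (hV : ⨆ i, V i = ⊤)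
    {𝒞 : Order.Ideal (Submodule 𝒜 M)} {A : Set (Uq D)}
    (h : ∀ i, ∀ y ∈ V i, ∃ E ∈ 𝒞, ∀ a ∈ A, incl D a • y ∈ E) : HasOrbitsIn D 𝒞 A := by
  intro y
  have hy : y ∈ ⨆ i, V i := hV ▸ Submodule.mem_top
  induction hy using Submodule.iSup_induction' with
  | mem i y hy => exact h i y hy
  | zero => exact ⟨⊥, 𝒞.bot_mem, fun a _ => by rw [smul_zero]; exact zero_mem _⟩
  | add y z _ _ hy hz =>
    obtain ⟨E, hE, hEy⟩ := hy
    obtain ⟨E', hE', hEz⟩ := hz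
    refine ⟨E ⊔ E', Order.Ideal.sup_mem hE hE', fun a ha => ?_⟩
    rw [smul_add]
    exact add_mem (Submodule.mem_sup_left (hEy a ha)) (Submodule.mem_sup_right (hEz a ha))

variable [IsScalarTower Cu (UqCu D) M]

/-- The action of an element of `U_q(ĝ)` as an `𝒜`-linear map. -/
noncomputable abbrev act𝒜 (M : Type*) [AddCommGroup M] [Module (UqCu D) M] [Module Cu M]
    [IsScalarTower Cu (UqCu D) M] (a : Uq D) : M →ₗ[𝒜] M :=
  (act D M a).restrictScalars 𝒜

variable {D} in
lemma HasOrbitsIn.exists_map_le {𝒞 : Order.Ideal (Submodule 𝒜 M)} {A : Set (Uq D)}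
    (hA : HasOrbitsIn D 𝒞 A) {F : Submodule 𝒜 M} (hF : F.FG) :
    ∃ E ∈ 𝒞, ∀ a ∈ A, F.map (act𝒜 D M a) ≤ E := by
  induction F, hF using Submodule.fg_induction with
  | singleton y =>
    obtain ⟨E, hE, hEy⟩ := hA y
    refine ⟨E, hE, fun a ha => ?_⟩
    rw [Submodule.map_span, Set.image_singleton, Submodule.span_singleton_le_iff_mem]
    exact hEy a ha
  | sup F F' _ _ ih ih' =>
    obtain ⟨E, hE, hEF⟩ := ih
    obtain ⟨E', hE', hEF'⟩ := ih'
    refine ⟨E ⊔ E', Order.Ideal.sup_mem hE hE', fun a ha => ?_⟩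
    rw [Submodule.map_sup]
    exact sup_le_sup (hEF a ha) (hEF' a ha)

variable {D} in
lemma HasOrbitsIn.mul {𝒞 : Order.Ideal (Submodule 𝒜 M)} {B A : Submodule ℂ (Uq D)}
    (hB : HasOrbitsIn D 𝒞 (B : Set (Uq D))) (hA : HasOrbitsIn D (fgIdeal 𝒜 M) (A : Set (Uq D))) :
    HasOrbitsIn D 𝒞 (B * A : Submodule ℂ (Uq D)) := by
  intro y
  obtain ⟨F, hF, hAF⟩ := hA y
  obtain ⟨E, hE, hBE⟩ := hB.exists_map_le hF
  refine ⟨E, hE, fun c hc =>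
    Submodule.mul_induction_on hc (fun b hb a ha => ?_) fun a b ha hb => ?_⟩
  · rw [map_mul, mul_smul]
    exact hBE b hb ⟨_, hAF a ha, rfl⟩
  · rw [map_add, add_smul]
    exact add_mem ha hb

/-- The weight spaces as `𝒜`-submodules. -/
noncomputable abbrev weightSpace𝒜 (M : Type*) [AddCommGroup M] [Module (UqCu D) M] [Module Cu M]
    [IsScalarTower Cu (UqCu D) M] (ω : Module.Dual ℚ 𝔥) : Submodule 𝒜 M :=
  (weightSpaceCu D M ω).restrictScalars 𝒜

/-- The order ideal of the `𝒜`-submodules contained in a sum of finitely generated submodules of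
the weight spaces, one for each weight. -/
def weightFiniteIdeal (M : Type*) [AddCommGroup M] [Module (UqCu D) M] [Module Cu M]
    [IsScalarTower Cu (UqCu D) M] : Order.Ideal (Submodule 𝒜 M) where
  carrier := {E | ∃ P : Module.Dual ℚ 𝔥 → Submodule 𝒜 M,
    (∀ ω, (P ω).FG ∧ P ω ≤ weightSpace𝒜 D M ω) ∧ E ≤ ⨆ ω, P ω}
  lower' := fun _ _ hle ⟨P, hP, hE⟩ => ⟨P, hP, hle.trans hE⟩
  nonempty' := ⟨⊥, fun _ => ⊥, fun _ => ⟨Submodule.fg_bot, bot_le⟩, bot_le⟩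
  directed' := fun E ⟨P, hP, hE⟩ E' ⟨P', hP', hE'⟩ =>
    ⟨E ⊔ E', ⟨P ⊔ P', fun ω => ⟨(hP ω).1.sup (hP' ω).1, sup_le (hP ω).2 (hP' ω).2⟩,
      sup_le (hE.trans (iSup_mono fun _ => le_sup_left))
        (hE'.trans (iSup_mono fun _ => le_sup_right))⟩, le_sup_left, le_sup_right⟩

variable {D} in
lemma fg_inf_weightSpace𝒜 {E : Submodule 𝒜 M} (hE : E ∈ weightFiniteIdeal D M)
    (ω : Module.Dual ℚ 𝔥) : (E ⊓ weightSpace𝒜 D M ω).FG := by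
  obtain ⟨P, hP, hEP⟩ := hE
  refine (fgIdeal 𝒜 M).lower ?_ (hP ω).1
  calc E ⊓ weightSpace𝒜 D M ω ≤ weightSpace𝒜 D M ω ⊓ ⨆ ω, P ω :=
        inf_comm E _ ▸ inf_le_inf_left _ hEP
    _ = P ω := inf_iSup_eq_of_iSupIndep (iSupIndep_restrictScalars_weightSpaceCu D 𝒜)
        (fun ω => (hP ω).2) ω

end Orbits

section Words

variable {M : Type*} [AddCommGroup M] [Module (UqCu D) M] [Module Cu M]
  [IsScalarTower Cu (UqCu D) M]

/-- The `𝒜`-submodule generated by the `x^ε_{i₁, r₁} ⋯ x^ε_{iₙ, rₙ} v`, for a given sequence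
of indices `i₁, …, iₙ` and all `r₁, …, rₙ`. -/
noncomputable def xWord (ε : ℤˣ) (v : M) : List I → Submodule 𝒜 M
  | [] => Submodule.span 𝒜 {v}
  | i :: l => ⨆ r : ℤ, (xWord ε v l).map (act𝒜 D M (Uq.x D ε i r))

lemma xAlg_smul_mem (ε : ℤˣ) (v : M) {a : Uq D} (ha : a ∈ xAlg D ε) :
    incl D a • v ∈ ⨆ l, xWord D ε v l := by
  suffices ∀ z ∈ ⨆ l, xWord D ε v l, incl D a • z ∈ ⨆ l, xWord D ε v l from
    this v (Submodule.mem_iSup_of_mem [] (Submodule.mem_span_singleton_self v))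
  induction ha using Algebra.adjoin_induction with
  | mem a ha =>
    obtain ⟨⟨i, r⟩, rfl⟩ := ha
    have hle : ⨆ l, xWord D ε v l ≤ (⨆ l, xWord D ε v l).comap (act𝒜 D M (Uq.x D ε i r)) :=
      iSup_le fun l z hz =>
        Submodule.mem_iSup_of_mem (i :: l) (Submodule.mem_iSup_of_mem r ⟨z, hz, rfl⟩)
    exact hle
  | algebraMap c =>
    intro z hz
    rw [AlgHom.commutes, IsScalarTower.algebraMap_apply ℂ Cu (UqCu D), algebraMap_smul]
    exact Submodule.smul_mem _ (algebraMap ℂ 𝒜 c) hz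
  | add a b _ _ ha hb =>
    intro z hz
    rw [map_add, add_smul]
    exact add_mem (ha z hz) (hb z hz)
  | mul a b _ _ ha hb =>
    intro z hz
    rw [map_mul, mul_smul]
    exact ha _ (hb z hz)

variable [Module ℂ M] [IsScalarTower ℂ Cu M] [IsScalarTower ℂ (UqCu D) M]

lemma xWord_le_weightSpace𝒜 {ω : Module.Dual ℚ 𝔥} {v : M} (hv : v ∈ weightSpaceCu D M ω) (ε : ℤˣ)
    (l : List I) : xWord D ε v l ≤ weightSpace𝒜 D M (ω + (ε : ℤ) • (l.map D.root).sum) := by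
  induction l with
  | nil =>
    rw [List.map_nil, List.sum_nil, smul_zero, add_zero, xWord, Submodule.span_singleton_le_iff_mem]
    exact hv
  | cons i l ih =>
    refine iSup_le fun r => ?_
    rintro _ ⟨y, hy, rfl⟩
    rw [List.map_cons, List.sum_cons, smul_add, add_comm (_ • D.root i), ← add_assoc]
    exact x_smul_mem D (ih hy) ε i r

namespace IsGenerating

variable {D} {W : Submodule ℂ M} (hW : IsGenerating D W)

include hW

lemma hasOrbitsIn_range_x (ε : ℤˣ) (i : I) :
    HasOrbitsIn D (fgIdeal 𝒜 M) (Set.range (Uq.x D ε i)) :=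
  .of_iSup_eq_top hW.iSup_weightSpaceCu fun _ _ hy => by
    obtain ⟨E, hfg, hE⟩ := hW.exists_fg_x_smul hy ε i
    exact ⟨E, hfg, Set.forall_mem_range.2 hE⟩

lemma fg_xWord (ε : ℤˣ) (v : M) (l : List I) : (xWord D ε v l).FG := by
  induction l with
  | nil => exact Submodule.fg_span_singleton v
  | cons i l ih =>
    obtain ⟨E, hfg, hE⟩ := (hW.hasOrbitsIn_range_x ε i).exists_map_le ih
    exact (fgIdeal 𝒜 M).lower (iSup_le fun r => hE _ ⟨r, rfl⟩) hfg

lemma exists_length_bound (ω : Module.Dual ℚ 𝔥) :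
    ∃ n : ℕ, ∀ l : List I, weightSpaceCu D M (ω + (l.map D.root).sum) ≠ ⊥ → l.length ≤ n := by
  obtain ⟨ρ, hρ⟩ := D.exists_height
  obtain ⟨S, hS⟩ := hW.cartan.bounded
  refine ⟨S.sup fun lam => ⌈ρ (lam - ω)⌉₊, fun l hl => ?_⟩
  rw [Ne, hW.weightSpaceCu_eq_bot_iff] at hl
  obtain ⟨lam, hlam, n, hn⟩ := hS _ hl
  refine le_trans ?_ (Finset.le_sup (f := fun lam => ⌈ρ (lam - ω)⌉₊) hlam)
  have hnonneg : 0 ≤ ρ (∑ i, n i • D.root i) := by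
    simp only [map_sum, map_nsmul, hρ]
    positivity
  rw [← hn, ← sub_sub, map_sub, height_sum_roots hρ, sub_nonneg] at hnonneg
  exact_mod_cast hnonneg.trans (Nat.le_ceil _)

lemma hasOrbitsIn_xAlg_one : HasOrbitsIn D (fgIdeal 𝒜 M) (xAlg D 1 : Set (Uq D)) := by
  refine .of_iSup_eq_top hW.iSup_weightSpaceCu fun ω v hv => ?_
  refine ⟨⨆ l, xWord D 1 v l, ?_, fun a ha => xAlg_smul_mem D 1 v ha⟩
  obtain ⟨n, hn⟩ := hW.exists_length_bound ω
  have hbot (l : List I) (hl : ¬ l.length ≤ n) : xWord D 1 v l = ⊥ := by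
    have hle := xWord_le_weightSpace𝒜 D hv 1 l
    rw [Units.val_one, one_smul, weightSpace𝒜, not_imp_comm.1 (hn l) hl] at hle
    exact le_bot_iff.1 hle
  refine (fgIdeal 𝒜 M).lower (iSup_le fun l => ?_) (Submodule.fg_biSup
    (List.finite_length_le I n).toFinset (xWord D 1 v) fun l _ => hW.fg_xWord 1 v l)
  by_cases hl : l.length ≤ n
  · exact le_iSup₂_of_le l ((List.finite_length_le I n).mem_toFinset.2 hl) le_rfl
  · exact (hbot l hl).trans_le bot_le

lemma hasOrbitsIn_UqCartan : HasOrbitsIn D (fgIdeal 𝒜 M) (UqCartan D : Set (Uq D)) :=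
  .of_iSup_eq_top hW.iSup_weightSpaceCu fun _ _ hy => hW.exists_fg_UqCartan_smul hy

lemma hasOrbitsIn_xAlg_neg_one :
    HasOrbitsIn D (weightFiniteIdeal D M) (xAlg D (-1) : Set (Uq D)) := by
  refine .of_iSup_eq_top hW.iSup_weightSpaceCu fun ω v hv => ?_
  refine ⟨⨆ l, xWord D (-1) v l, ?_, fun a ha => xAlg_smul_mem D (-1) v ha⟩
  have hfin (lam) := finite_setOf_sum_roots_eq D (ω - lam)
  refine ⟨fun lam => ⨆ l ∈ (hfin lam).toFinset, xWord D (-1) v l, fun lam =>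
    ⟨Submodule.fg_biSup _ _ fun l _ => hW.fg_xWord (-1) v l, iSup₂_le fun l hl => ?_⟩,
    iSup_le fun l => ?_⟩
  · have hle := xWord_le_weightSpace𝒜 D hv (-1) l
    rwa [(hfin lam).mem_toFinset.1 hl, Units.val_neg, Units.val_one, neg_one_smul, neg_sub,
      add_sub_cancel] at hle
  · exact le_iSup_of_le (ω - (l.map D.root).sum)
      (le_iSup₂_of_le l ((hfin _).mem_toFinset.2 (sub_sub_cancel _ _).symm) le_rfl)

lemma hasOrbitsIn_univ : HasOrbitsIn D (weightFiniteIdeal D M) Set.univ := by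
  have h := HasOrbitsIn.mul
    (B := toSubmodule (xAlg D (-1)) * toSubmodule (UqCartan D)) (A := toSubmodule (xAlg D 1))
    (.mul (B := toSubmodule (xAlg D (-1))) (A := toSubmodule (UqCartan D))
      hW.hasOrbitsIn_xAlg_neg_one hW.hasOrbitsIn_UqCartan) hW.hasOrbitsIn_xAlg_one
  rwa [triangular_decomposition, Submodule.top_coe] at h

end IsGenerating

end Words

section CyclicForm

lemma tmul_eq_smul_incl (c : Cu) (b : Uq D) : (c ⊗ₜ b : UqCu D) = c • incl D b := by
  simp [incl, TensorProduct.smul_tmul']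

variable {D} {M : Type*} [AddCommGroup M] [Module (UqCu D) M]

lemma exists_smul_cycGen (v : M) (x : cyc D v) : ∃ a : UqCu D, a • cycGen D v = x := by
  obtain ⟨a, ha⟩ := Submodule.mem_span_singleton.1 x.2
  exact ⟨a, Subtype.ext ha⟩

variable [Module Cu M] [IsScalarTower Cu (UqCu D) M]

lemma smul_mem_of_mem_UqA {K : Submodule 𝒜 M} {v : M} (h : ∀ a, incl D a • v ∈ K)
    {a : UqCu D} (ha : a ∈ UqA D) : a • v ∈ K := by
  obtain ⟨t, rfl⟩ := ha
  induction t using TensorProduct.induction_on with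
  | zero => rw [map_zero, zero_smul]; exact zero_mem _
  | tmul c b =>
    change ((c : Cu) ⊗ₜ[ℂ] b) • v ∈ K
    rw [tmul_eq_smul_incl, smul_assoc]
    exact K.smul_mem c (h b)
  | add x y hx hy =>
    rw [map_add, add_smul]
    exact add_mem hx hy

lemma smul_mem_of_forall_incl {K : Submodule Cu M} {v : M} (h : ∀ a, incl D a • v ∈ K)
    (a : UqCu D) : a • v ∈ K := by
  induction a using TensorProduct.induction_on with
  | zero => rw [zero_smul]; exact zero_mem _
  | tmul c b =>
    rw [tmul_eq_smul_incl, smul_assoc]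
    exact K.smul_mem c (h b)
  | add x y hx hy =>
    rw [add_smul]
    exact add_mem hx hy

variable [Module ℂ M] [IsScalarTower ℂ Cu M] [IsScalarTower ℂ (UqCu D) M]

lemma isAForm_cycForm {v : M} (hM : InModUqCu D (cyc D v)) :
    IsAForm D (cyc D v) (cycForm D v) where
  stable := by
    rintro a ha _ ⟨b, hb, rfl⟩
    exact ⟨a * b, mul_mem ha hb, mul_smul a b _⟩
  span_eq := by
    rw [eq_top_iff]
    rintro x -
    obtain ⟨a, rfl⟩ := exists_smul_cycGen v x
    exact smul_mem_of_forall_incl (K := Submodule.span Cu (cycForm D v : Set (cyc D v)))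
      (fun b => Submodule.subset_span ⟨incl D b, incl_mem_UqA D b, rfl⟩) a
  fg := by
    obtain ⟨W, hW⟩ := hM.exists_generating
    obtain ⟨E, hE, hvE⟩ := hW.hasOrbitsIn_univ (cycGen D v)
    refine fg_inf_weightSpace𝒜 ((weightFiniteIdeal D (cyc D v)).lower ?_ hE)
    rintro _ ⟨a, ha, rfl⟩
    exact smul_mem_of_mem_UqA (fun b => hvE b trivial) ha

end CyclicForm

/-! ## The specialization of an `𝒜`-form -/

namespace Spec1

variable {D} {M : Type*} [AddCommGroup M] [Module (UqCu D) M] [Module Cu M]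
  [IsScalarTower Cu (UqCu D) M] {L : Submodule 𝒜 M} (hL : IsAForm D M L)

lemma mk_surjective : Function.Surjective (mk D hL) := Submodule.mkQ_surjective _

instance : IsScalarTower ℂ 𝒜 (Spec1 D hL) := .of_algebraMap_smul fun c z => by
  obtain ⟨x, rfl⟩ := mk_surjective hL z
  change _ = algebraMap ℂ (Uq D) c • mk D hL x
  rw [smul_mk, ← map_smul]
  refine congrArg (mk D hL) (Subtype.ext ?_)
  symm
  change incl D (algebraMap ℂ (Uq D) c) • (x : M) = algebraMap ℂ Cu c • (x : M)
  rw [AlgHom.commutes, IsScalarTower.algebraMap_apply ℂ Cu (UqCu D), algebraMap_smul]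

lemma uSubOne_smul (z : Spec1 D hL) : uSubOne • z = 0 := by
  obtain ⟨x, rfl⟩ := mk_surjective hL z
  exact (Submodule.Quotient.mk_eq_zero _).2 ⟨x, rfl⟩

lemma exists_complex_smul_eq (f : 𝒜) : ∃ c : ℂ, ∀ z : Spec1 D hL, f • z = c • z := by
  obtain ⟨c, y, rfl⟩ := exists_eq_algebraMap_add_uSubOne_mul f
  refine ⟨c, fun z => ?_⟩
  rw [add_smul, mul_smul, uSubOne_smul, add_zero, algebraMap_smul]

lemma span_𝒜_eq_span_complex (s : Set (Spec1 D hL)) :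
    (Submodule.span 𝒜 s).restrictScalars ℂ = Submodule.span ℂ s := by
  refine le_antisymm (fun z hz => ?_) (Submodule.span_le_restrictScalars ℂ 𝒜 s)
  induction hz using Submodule.span_induction with
  | mem z hz => exact Submodule.subset_span hz
  | zero => exact zero_mem _
  | add z z' _ _ hz hz' => exact add_mem hz hz'
  | smul f z _ hz =>
    obtain ⟨c, hc⟩ := exists_complex_smul_eq hL f
    exact hc z ▸ Submodule.smul_mem _ c hz

lemma span_mk_eq_top {g : L} (hg : ∀ x : L, ∃ a ∈ UqA D, a • (g : M) = x) :
    Submodule.span (Uq D) {mk D hL g} = ⊤ := by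
  let K : Submodule 𝒜 (Spec1 D hL) :=
    { Submodule.span (Uq D) {mk D hL g} with
      smul_mem' := fun f z hz => by
        obtain ⟨c, hc⟩ := exists_complex_smul_eq hL f
        rw [hc]
        exact (Submodule.span (Uq D) {mk D hL g}).smul_mem (algebraMap ℂ (Uq D) c) hz }
  have horbit (b : Uq D) : incl D b • (g : M) ∈ (K.comap (mk D hL)).map L.subtype :=
    ⟨actForm D hL b g, Submodule.smul_mem _ b (Submodule.mem_span_singleton_self _), rfl⟩
  rw [eq_top_iff]
  rintro z -
  obtain ⟨x, rfl⟩ := mk_surjective hL z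
  obtain ⟨a, ha, hax⟩ := hg x
  obtain ⟨y, hy, hya⟩ := smul_mem_of_mem_UqA horbit ha
  obtain rfl : y = x := Subtype.ext (hya.trans hax)
  exact hy

variable (D L) in
/-- The weight `ω` part of an `𝒜`-submodule. -/
noncomputable abbrev wtForm (ω : Module.Dual ℚ 𝔥) : Submodule 𝒜 L :=
  (weightSpace𝒜 D M ω).comap L.subtype

include hL in
lemma fg_wtForm (ω : Module.Dual ℚ 𝔥) : (wtForm D L ω).FG := by
  refine Submodule.fg_of_fg_map_injective L.subtype L.injective_subtype ?_
  rw [Submodule.map_comap_subtype]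
  exact hL.fg ω

lemma map_mk_wtForm_le (ω : Module.Dual ℚ 𝔥) : ((wtForm D L ω).map (mk D hL)).restrictScalars ℂ ≤
    weightSpace D (fun h => Algebra.lsmul ℂ ℂ (Spec1 D hL) (Uq.k D h)) ω := by
  rintro _ ⟨x, hx, rfl⟩ h
  change Uq.k D h • mk D hL x = D.qpow (ω h) • mk D hL x
  rw [smul_mk, ← algebraMap_smul 𝒜 (D.qpow (ω h)), ← map_smul]
  exact congrArg (mk D hL) (Subtype.ext (hx h))

variable [Module ℂ M] [IsScalarTower ℂ Cu M] [IsScalarTower ℂ (UqCu D) M] {W : Submodule ℂ M}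
  (hW : IsGenerating D W)

include hL hW

lemma iSup_wtForm : ⨆ ω, wtForm D L ω = ⊤ := by
  refine Submodule.restrictScalars_injective ℂ 𝒜 L ?_
  rw [Submodule.restrictScalars_iSup]
  have htop : ⨆ ω, weightSpace D (kActC D M) ω = ⊤ := by
    have hω (ω : Module.Dual ℚ 𝔥) :
        weightSpace D (kActC D M) ω = (weightSpaceCu D M ω).restrictScalars ℂ :=
      Submodule.ext fun _ => mem_weightSpace_kActC D
    simp only [hω, ← Submodule.restrictScalars_iSup, hW.iSup_weightSpaceCu,
      Submodule.restrictScalars_top]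
  have hN (h : 𝔥) : L.restrictScalars ℂ ≤ (L.restrictScalars ℂ).comap (kActC D M h) :=
    fun x hx => hL.stable _ (incl_mem_UqA D _) x hx
  refine .trans (iSup_congr fun ω => Submodule.ext fun x => (mem_weightSpace_kActC D).symm)
    (iSup_comap_subtype_eq_top (inf_iSup_weightSpace D hN) htop)

lemma iSup_map_mk_wtForm : ⨆ ω, ((wtForm D L ω).map (mk D hL)).restrictScalars ℂ = ⊤ := by
  rw [← Submodule.restrictScalars_iSup, ← Submodule.map_iSup, iSup_wtForm hL hW,
    Submodule.map_top, LinearMap.range_eq_top.2 (mk_surjective hL), Submodule.restrictScalars_top]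

lemma weightSpace_eq_map_mk_wtForm (ω : Module.Dual ℚ 𝔥) :
    weightSpace D (fun h => Algebra.lsmul ℂ ℂ (Spec1 D hL) (Uq.k D h)) ω =
      ((wtForm D L ω).map (mk D hL)).restrictScalars ℂ := by
  rw [← inf_iSup_eq_of_iSupIndep (iSupIndep_weightSpace D _) (map_mk_wtForm_le hL) ω,
    iSup_map_mk_wtForm hL hW, inf_top_eq]

lemma inModUq : InModUq D (Spec1 D hL) := by
  refine hW.cartan.of_weightSpace_eq_bot ?_ (fun ω => ?_) fun ω hω => ?_
  · simp only [top_inf_eq, weightSpace_eq_map_mk_wtForm hL hW]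
    exact iSup_map_mk_wtForm hL hW
  · rw [top_inf_eq, weightSpace_eq_map_mk_wtForm hL hW]
    obtain ⟨s, hs⟩ := (fg_wtForm hL ω).map (mk D hL)
    rw [← hs, span_𝒜_eq_span_complex]
    exact FiniteDimensional.span_finset ℂ s
  · rw [top_inf_eq, weightSpace_eq_map_mk_wtForm hL hW, wtForm, weightSpace𝒜,
      (hW.weightSpaceCu_eq_bot_iff ω).2 hω, Submodule.restrictScalars_bot, Submodule.comap_bot,
      L.ker_subtype, Submodule.map_bot, Submodule.restrictScalars_bot]

lemma nontrivial [Nontrivial M] : Nontrivial (Spec1 D hL) := by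
  by_contra hspec
  rw [not_nontrivial_iff_subsingleton] at hspec
  have hdiv (ω : Module.Dual ℚ 𝔥) :
      wtForm D L ω ≤ IsLocalRing.maximalIdeal 𝒜 • wtForm D L ω := fun x hx => by
    obtain ⟨y, rfl⟩ :=
      (Submodule.Quotient.mk_eq_zero _).1 (Subsingleton.elim (mk D hL x) 0)
    rw [maximalIdeal_𝒜]
    refine Submodule.smul_mem_smul (Ideal.mem_span_singleton_self _) ?_
    exact ((weightSpaceCu D M ω).smul_mem_iff uSubOne_ne_zero).1 hx
  have hzero (ω : Module.Dual ℚ 𝔥) : wtForm D L ω = ⊥ :=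
    Submodule.eq_bot_of_le_smul_of_le_jacobson_bot _ _ (fg_wtForm hL ω) (hdiv ω)
      (IsLocalRing.maximalIdeal_le_jacobson _)
  have hLbot : L = ⊥ := by
    rw [← L.map_subtype_top, ← iSup_wtForm hL hW, iSup_congr hzero, iSup_bot, Submodule.map_bot]
  have hspan := hL.span_eq
  rw [hLbot, Submodule.bot_coe, Submodule.span_zero_singleton] at hspan
  exact bot_ne_top hspan

end Spec1

end QAff

theorem theorem4p6 {I : Type*} [Fintype I] [DecidableEq I]
    {𝔥 : Type*} [AddCommGroup 𝔥] [Module ℚ 𝔥] (D : QAff.Datum I 𝔥)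
    {V : Type*} [AddCommGroup V] [Module (QAff.UqCu D) V]
    [Module QAff.Cu V] [IsScalarTower QAff.Cu (QAff.UqCu D) V]
    [Module ℂ V] [IsScalarTower ℂ QAff.Cu V] [IsScalarTower ℂ (QAff.UqCu D) V]
    (hV : QAff.InModUqCu D V) (v : V) (hv : v ≠ 0) :
    QAff.InModUqCu D (QAff.cyc D v) ∧
    ∃ hL : QAff.IsAForm D (QAff.cyc D v) (QAff.cycForm D v),
      QAff.InModUq D (QAff.Spec1 D hL) ∧
      Nontrivial (QAff.Spec1 D hL) ∧
      Submodule.span (QAff.Uq D) {QAff.Spec1.mk D hL (QAff.cycFormGen D v)} = ⊤ := by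
  have hN := hV.submodule (QAff.cyc D v)
  have hL := QAff.isAForm_cycForm hN
  obtain ⟨W, hW⟩ := hN.exists_generating
  have : Nontrivial (QAff.cyc D v) :=
    ⟨⟨QAff.cycGen D v, 0, fun h => hv (congrArg Subtype.val h)⟩⟩
  exact ⟨hN, hL, QAff.Spec1.inModUq hL hW, QAff.Spec1.nontrivial hL hW,
    QAff.Spec1.span_mk_eq_top hL fun x => x.2⟩
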